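/- Let $n\ge 1$ and let $p$ be a prime. Inside $\mathbb Z_p^{2n}$ (colorings of $2n$ points on a circle, with standard basis $e_1,\dots,e_{2n}$) let $\mathbb Z_p^{2n-1}$ be the subspace of vectors $\sum a_ie_i$ with $\sum(-1)^ia_i=0$; it has the basis $f_k=e_k+e_{k+1}$ $(1\le k\le 2n-1)$. Let $\phi$ be the skew-symmetric bilinear form on it with $\phi(f_i,f_{i+1})=1$, $\phi(f_{i+1},f_i)=-1$ and $\phi(f_i,f_j)=0$ if $|i-j|\ne 1$. It vanishes on $e_1+\dots+e_{2n}$ and so induces a form $\hat\phi$ on $\mathbb Z_p^{2n-2}:=\mathbb Z_p^{2n-1}/\langle e_1+\dots+e_{2n}\rangle$. A Lagrangian is a maximal isotropic subspace of $(\mathbb Z_p^{2n-2},\hat\phi)$. An $n$-tangle $T$ is given by a diagram in a disk with $2n$ endpoints on the boundary circle. $\mathrm{Col}_pT$ is the space of Fox $p$-colorings: colorings of the arcs by elements of $\mathbb Z_p$ such that at each crossing the sum of the colors of the two undercrossing arcs is twice the color of the overcrossing arc. Restricting a coloring to the endpoints defines $\psi:\mathrm{Col}_pT\to\mathbb Z_p^{2n-1}\subset\mathbb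 Z_p^{2n}$ and, modulo the monochromatic colorings, $\hat\psi:\mathrm{Col}_pT/\mathbb Z_p\to\mathbb Z_p^{2n-2}$. The tangle $T$ realizes the subspace $\hat\psi(\mathrm{Col}_pT/\mathbb Z_p)$. An $n$-tangle is rational if it is the image of an $n$-tangle without crossings and without closed components under a homeomorphism of the ball (possibly moving the boundary); equivalently, if it has a diagram obtained from a diagram without crossings and closed components by successively adding crossings between neighbouring endpoints. (i) If $p$ is odd, every Lagrangian in $(\mathbb Z_p^{2n-2},\hat\phi)$ is realized by some $n$-tangle, which can be chosen to be rational. (ii) If $p=2$ and $n>3$, not every Lagrangian is realized by an $n$-tangle. For $p=2$ and every $n\ge1$, exactly $\prod_{i=1}^{n-1}(2i+1)$ Lagrangians are realized by $n$-tangles, and this is also the number of different subspaces $\psi(\mathrm{Col}_2T)$ of $\mathbb Z_2^{2n}$ for $n$-tangles $T$; the total number of Lagrangians is $\prod_{i=1}^{n-1}(2^i+1)$. -/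

import Mathlib

/-! ### Tangle diagrams -/

/-- `TangleDiagram m`: unoriented tangle diagrams in a disk with `m` endpoints on its boundary
circle, numbered `0, …, m - 1` in their cyclic order.  Diagrams are given in general position with
respect to a height function (all endpoints on the bottom line, ordered from left to right): such a
diagram is a sequence of slices, read downwards, each holding one local maximum, one local minimum
or one crossing.  Every tangle diagram is planar isotopic to one of this form, and each such
sequence is a diagram. An `n`-tangle (diagram) is an element of `TangleDiagram (2 * n)`. -/
inductive TangleDiagram : ℕ → Type
  /-- the empty diagram -/
  | empty : TangleDiagram 0
  /-- a local maximum: a new arc whose two ends become the endpoints `k` and `k + 1` -/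
  | cap {m : ℕ} (D : TangleDiagram m) (k : Fin (m + 1)) : TangleDiagram (m + 2)
  /-- a local minimum: the endpoints `k` and `k + 1` are joined (without a crossing) -/
  | join {m : ℕ} (D : TangleDiagram (m + 2)) (k : Fin (m + 1)) : TangleDiagram m
  /-- a crossing of the strands at `k` and `k + 1`; the strand running from `k` to `k + 1` is the
  overcrossing one if `s = true`, and the undercrossing one if `s = false` -/
  | cross {m : ℕ} (D : TangleDiagram (m + 2)) (k : Fin (m + 1)) (s : Bool) : TangleDiagram (m + 2)

/-- A crossing between arcs labelled by elements of `S`: the arc passing over, and the two arcs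
that end at the crossing because they pass under. -/
structure Crossing (S : Type) where
  overArc : S
  underArc₁ : S
  underArc₂ : S

/-- Relabelling the arcs at a crossing. -/
def Crossing.map {S S' : Type} (f : S → S') (c : Crossing S) : Crossing S' :=
  ⟨f c.overArc, f c.underArc₁, f c.underArc₂⟩

namespace TangleDiagram

/-- The pieces into which the diagram falls when it is cut at all undercrossings and at all local
minima.  A local maximum starts a new piece; at a crossing the piece of the overcrossing strand
continues and a new piece (`none`) starts for the undercrossing strand. -/
def Piece : {m : ℕ} → TangleDiagram m → Type
  | _, empty => Empty
  | _, cap D _ => Option D.Piece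
  | _, join D _ => D.Piece
  | _, cross D _ _ => Option D.Piece

/-- The piece that ends at a given endpoint. -/
def endPiece : {m : ℕ} → (D : TangleDiagram m) → Fin m → D.Piece
  | _, empty => fun i => i.elim0
  | _, cap D k => k.castSucc.insertNth (α := fun _ => Option D.Piece) none
      (k.insertNth (α := fun _ => Option D.Piece) none fun i => some (D.endPiece i))
  | _, join D k => k.removeNth (k.castSucc.removeNth D.endPiece)
  | _, cross D k true => fun i =>
      if i = k.castSucc then none
      else if i = k.succ then some (D.endPiece k.castSucc)
      else some (D.endPiece i)
  | _, cross D k false => fun i =>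
      if i = k.castSucc then some (D.endPiece k.succ)
      else if i = k.succ then none
      else some (D.endPiece i)

/-- The pairs of pieces that meet at the local minima. -/
def joints : {m : ℕ} → (D : TangleDiagram m) → List (D.Piece × D.Piece)
  | _, empty => []
  | _, cap D _ => D.joints.map (Prod.map some some)
  | _, join D k => (D.endPiece k.castSucc, D.endPiece k.succ) :: D.joints
  | _, cross D _ _ => D.joints.map (Prod.map some some)

/-- The crossings, in terms of the pieces that meet there. -/
def pieceCrossings : {m : ℕ} → (D : TangleDiagram m) → List (Crossing D.Piece)
  | _, empty => []
  | _, cap D _ => D.pieceCrossings.map (Crossing.map some)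
  | _, join D _ => D.pieceCrossings
  | _, cross D k true =>
      ⟨some (D.endPiece k.castSucc), some (D.endPiece k.succ), none⟩ ::
        D.pieceCrossings.map (Crossing.map some)
  | _, cross D k false =>
      ⟨some (D.endPiece k.succ), some (D.endPiece k.castSucc), none⟩ ::
        D.pieceCrossings.map (Crossing.map some)

/-- The arcs of the diagram (they end only at undercrossings and at endpoints): the pieces, glued
together at the local minima. -/
def Arc {m : ℕ} (D : TangleDiagram m) : Type :=
  Quot fun s t : D.Piece => (s, t) ∈ D.joints

/-- The arc that ends at a given endpoint. -/
def endArc {m : ℕ} (D : TangleDiagram m) (i : Fin m) : D.Arc := Quot.mk _ (D.endPiece i)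

/-- The crossings of the diagram, in terms of its arcs. -/
def crossings {m : ℕ} (D : TangleDiagram m) : List (Crossing D.Arc) :=
  D.pieceCrossings.map (Crossing.map (Quot.mk _))

/-- Rational diagrams.  A rational `n`-tangle is the image of an `n`-tangle without crossings and
without closed components under a homeomorphism of the ball (which may move the boundary).  Up to
isotopy such homeomorphisms are products of half twists exchanging two neighbouring endpoints, and
applying a half twist adds one crossing between these endpoints. So a rational tangle is one that
has a diagram built from a diagram without crossings and closed components by successively adding
crossings between neighbouring endpoints. (In a diagram without crossings the arcs are the
components, so there is no closed component iff each arc reaches an endpoint.) -/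
inductive IsRational : {m : ℕ} → TangleDiagram m → Prop
  | crossingless {m : ℕ} (D : TangleDiagram m) (hcr : D.crossings = [])
      (hcl : Function.Surjective D.endArc) : IsRational D
  | twist {m : ℕ} (D : TangleDiagram (m + 2)) (k : Fin (m + 1)) (s : Bool) (h : IsRational D) :
      IsRational (cross D k s)

/-! ### Fox colorings -/

/-- The group of Fox `p`-colorings: the arcs are colored by elements of `ℤ/p` such that at each
crossing the sum of the colors of the undercrossings is twice the color of the overcrossing. -/
def Col (p : ℕ) {m : ℕ} (D : TangleDiagram m) : Submodule (ZMod p) (D.Arc → ZMod p) where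
  carrier := {c | ∀ x ∈ D.crossings, c x.underArc₁ + c x.underArc₂ = 2 * c x.overArc}
  zero_mem' := by simp
  add_mem' := by
    intro a b ha hb x hx
    have h1 := ha x hx
    have h2 := hb x hx
    simp only [Pi.add_apply]
    linear_combination h1 + h2
  smul_mem' := by
    intro r a ha x hx
    have h1 := ha x hx
    simp only [Pi.smul_apply, smul_eq_mul]
    linear_combination r * h1

/-- The coloring of the endpoints induced by a coloring of the diagram. -/
def psi (p : ℕ) {m : ℕ} (D : TangleDiagram m) : D.Col p →ₗ[ZMod p] (Fin m → ZMod p) :=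
  (LinearMap.funLeft (ZMod p) (ZMod p) D.endArc) ∘ₗ (D.Col p).subtype

/-- The coloring in which all arcs have color `1`. -/
def oneCol (p : ℕ) {m : ℕ} (D : TangleDiagram m) : D.Col p :=
  ⟨fun _ => 1, fun _ _ => by norm_num⟩

/-- The subspace `ℤ/p` of monochromatic (trivial) colorings. -/
def trivCol (p : ℕ) {m : ℕ} (D : TangleDiagram m) : Submodule (ZMod p) (D.Col p) :=
  Submodule.span (ZMod p) {D.oneCol p}

end TangleDiagram

/-! ### The symplectic space of boundary colorings -/

/-- The alternating sum `∑ (-1)^i a_i`. -/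
def altSum (p m : ℕ) : (Fin m → ZMod p) →ₗ[ZMod p] ZMod p :=
  ∑ i : Fin m, (-1 : ZMod p) ^ (i : ℕ) • LinearMap.proj i

theorem altSum_apply (p m : ℕ) (x : Fin m → ZMod p) :
    altSum p m x = ∑ i : Fin m, (-1 : ZMod p) ^ (i : ℕ) * x i := by
  simp [altSum]

/-- The space `ℤ_p^{2n-1}` of colorings of `2n` points that satisfy the alternating condition. -/
def AltSpace (p n : ℕ) : Submodule (ZMod p) (Fin (2 * n) → ZMod p) :=
  LinearMap.ker (altSum p (2 * n))

/-- Splitting off two neighbouring terms of an alternating sum. -/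
theorem altSum_split (p : ℕ) {m : ℕ} (k : Fin (m + 1)) (y : Fin (m + 2) → ZMod p) :
    altSum p (m + 2) y = (-1) ^ (k : ℕ) * (y k.castSucc - y k.succ) +
      altSum p m (k.removeNth (k.castSucc.removeNth y)) := by
  have hpar : ∀ i : Fin m, (-1 : ZMod p) ^ (k.castSucc.succAbove (k.succAbove i) : ℕ) =
      (-1) ^ (i : ℕ) := by
    intro i
    simp only [Fin.succAbove, Fin.lt_def]
    split_ifs <;> simp_all [pow_succ] <;> omega
  rw [altSum_apply, altSum_apply, Fin.sum_univ_succAbove _ k.castSucc, Fin.sum_univ_succAbove _ k]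
  simp only [hpar, Fin.succAbove_castSucc_self, Fin.removeNth_apply, Fin.val_castSucc,
    Fin.val_succ, pow_succ]
  ring

namespace TangleDiagram

theorem altSum_piece (p : ℕ) {m : ℕ} (D : TangleDiagram m) (c : D.Piece → ZMod p)
    (hj : ∀ q ∈ D.joints, c q.1 = c q.2)
    (hc : ∀ x ∈ D.pieceCrossings, c x.underArc₁ + c x.underArc₂ = 2 * c x.overArc) :
    altSum p m (fun i => c (D.endPiece i)) = 0 := by
  induction D with
  | empty => simp [altSum]
  | @cap m D k ih =>
    have h := ih (fun s => c (some s))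
      (fun q hq => hj (some q.1, some q.2) (List.mem_map.2 ⟨q, hq, rfl⟩))
      (fun x hx => hc (x.map some) (List.mem_map.2 ⟨x, hx, rfl⟩))
    rw [altSum_split p k]
    have h1 : (cap D k).endPiece k.castSucc = (none : Option D.Piece) := by
      simp only [endPiece, Fin.insertNth_apply_same]
      rfl
    have h2 : (cap D k).endPiece k.succ = (none : Option D.Piece) := by
      rw [← Fin.succAbove_castSucc_self k]
      simp only [endPiece, Fin.insertNth_apply_succAbove, Fin.insertNth_apply_same]
      rfl
    have h3 : (k.removeNth (k.castSucc.removeNth fun i => c ((cap D k).endPiece i))) =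
        fun i => c (some (D.endPiece i)) := by
      funext i
      simp only [Fin.removeNth_apply, endPiece, Fin.insertNth_apply_succAbove]
    rw [h3, h, h1, h2]
    simp
  | @join m D k ih =>
    have h := ih c (fun q hq => hj q (List.mem_cons_of_mem _ hq)) hc
    have h0 : c (D.endPiece k.castSucc) = c (D.endPiece k.succ) :=
      hj (D.endPiece k.castSucc, D.endPiece k.succ) List.mem_cons_self
    rw [altSum_split p k, h0, sub_self, mul_zero, zero_add] at h
    exact h
  | @cross m D k s ih =>
    have hne : k.succ ≠ k.castSucc := by simp [Fin.ext_iff]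
    have ha : ∀ i : Fin m, k.castSucc.succAbove (k.succAbove i) ≠ k.castSucc :=
      fun i => Fin.succAbove_ne _ _
    have hb : ∀ i : Fin m, k.castSucc.succAbove (k.succAbove i) ≠ k.succ := by
      intro i hi
      rw [← Fin.succAbove_castSucc_self k] at hi
      exact Fin.succAbove_ne _ _ (Fin.succAbove_right_injective hi)
    have hjj : ∀ q ∈ D.joints, c (some q.1) = c (some q.2) :=
      fun q hq => hj (some q.1, some q.2) (List.mem_map.2 ⟨q, hq, rfl⟩)
    cases s with
    | true =>
      have h := ih (fun s => c (some s)) hjj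
        (fun x hx => hc (x.map some) (List.mem_cons_of_mem _ (List.mem_map.2 ⟨x, hx, rfl⟩)))
      have h0 := hc ⟨some (D.endPiece k.castSucc), some (D.endPiece k.succ), none⟩
        List.mem_cons_self
      rw [altSum_split p k] at h ⊢
      have h3 : (k.removeNth (k.castSucc.removeNth fun i => c ((cross D k true).endPiece i))) =
          (k.removeNth (k.castSucc.removeNth fun i => c (some (D.endPiece i)))) := by
        funext i
        simp [Fin.removeNth_apply, endPiece, ha, hb]
      have e1 : (cross D k true).endPiece k.castSucc = (none : Option D.Piece) := if_pos rfl
      have e2 : (cross D k true).endPiece k.succ = (some (D.endPiece k.castSucc) : Option D.Piece) :=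
        (if_neg hne).trans (if_pos rfl)
      rw [h3, e1, e2]
      simp only at h0
      linear_combination h + (-1) ^ (k : ℕ) * h0
    | false =>
      have h := ih (fun s => c (some s)) hjj
        (fun x hx => hc (x.map some) (List.mem_cons_of_mem _ (List.mem_map.2 ⟨x, hx, rfl⟩)))
      have h0 := hc ⟨some (D.endPiece k.succ), some (D.endPiece k.castSucc), none⟩
        List.mem_cons_self
      rw [altSum_split p k] at h ⊢
      have h3 : (k.removeNth (k.castSucc.removeNth fun i => c ((cross D k false).endPiece i))) =
          (k.removeNth (k.castSucc.removeNth fun i => c (some (D.endPiece i)))) := by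
        funext i
        simp [Fin.removeNth_apply, endPiece, ha, hb]
      have e1 : (cross D k false).endPiece k.castSucc = (some (D.endPiece k.succ) : Option D.Piece) := if_pos rfl
      have e2 : (cross D k false).endPiece k.succ = (none : Option D.Piece) :=
        (if_neg hne).trans (if_pos rfl)
      rw [h3, e1, e2]
      simp only at h0
      linear_combination h - (-1) ^ (k : ℕ) * h0

/-- Induced boundary colorings satisfy the alternating condition. -/
theorem psi_mem (p : ℕ) {n : ℕ} (D : TangleDiagram (2 * n)) (c : D.Col p) :
    D.psi p c ∈ AltSpace p n := by
  refine D.altSum_piece p (fun s => c.1 (Quot.mk _ s)) ?_ ?_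
  · intro q hq
    exact congrArg c.1 (Quot.sound hq)
  · intro x hx
    exact c.2 (x.map (Quot.mk _)) (List.mem_map.2 ⟨x, hx, rfl⟩)

end TangleDiagram

/-- The vector `f_k = e_k + e_{k+1}`. -/
def fVec (p n : ℕ) (k : Fin (2 * n - 1)) : Fin (2 * n) → ZMod p :=
  Pi.single ⟨k, by omega⟩ 1 + Pi.single ⟨k + 1, by omega⟩ 1

theorem fVec_mem (p n : ℕ) (k : Fin (2 * n - 1)) : fVec p n k ∈ AltSpace p n := by
  simp [AltSpace, altSum_apply, fVec, Pi.single_apply, mul_add, Finset.sum_add_distrib, pow_succ]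

/-- Coordinates with respect to the `f_k`: the coordinates `b` of `x` are determined by
`b_0 = x_0` and `b_k + b_{k+1} = x_{k+1}`. -/
def fCoord (p n : ℕ) (x : Fin (2 * n) → ZMod p) : ℕ → ZMod p
  | 0 => if h : 0 < 2 * n then x ⟨0, h⟩ else 0
  | k + 1 => (if h : k + 1 < 2 * n then x ⟨k + 1, h⟩ else 0) - fCoord p n x k

theorem fCoord_add (p n : ℕ) (x y : Fin (2 * n) → ZMod p) (k : ℕ) :
    fCoord p n (x + y) k = fCoord p n x k + fCoord p n y k := by
  induction k with
  | zero => simp only [fCoord]; split_ifs <;> simp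
  | succ k ih => simp only [fCoord, ih]; split_ifs <;> simp <;> ring

theorem fCoord_smul (p n : ℕ) (r : ZMod p) (x : Fin (2 * n) → ZMod p) (k : ℕ) :
    fCoord p n (r • x) k = r * fCoord p n x k := by
  induction k with
  | zero => simp only [fCoord]; split_ifs <;> simp
  | succ k ih => simp only [fCoord, ih]; split_ifs <;> simp <;> ring

theorem fCoord_sum (p n : ℕ) (x : Fin (2 * n) → ZMod p) (k : ℕ) (hk : k < 2 * n) :
    (-1) ^ k * fCoord p n x k =
      ∑ j ∈ Finset.range (k + 1), if h : j < 2 * n then (-1) ^ j * x ⟨j, h⟩ else 0 := by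
  induction k with
  | zero => simp [fCoord, hk]
  | succ k ih =>
    rw [Finset.sum_range_succ, ← ih (by omega)]
    simp only [fCoord, hk, dif_pos, pow_succ]
    ring

theorem fCoord_last (p n : ℕ) (x : Fin (2 * n) → ZMod p) (hx : x ∈ AltSpace p n) (hn : 0 < n) :
    fCoord p n x (2 * n - 1) = 0 := by
  have h := fCoord_sum p n x (2 * n - 1) (by omega)
  rw [show 2 * n - 1 + 1 = 2 * n by omega, Finset.sum_range] at h
  have hx' : altSum p (2 * n) x = 0 := hx
  rw [altSum_apply] at hx'
  simp only [Fin.is_lt, dif_pos] at h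
  rw [hx'] at h
  have h2 : ((-1 : ZMod p) ^ (2 * n - 1)) * (-1) ^ (2 * n - 1) = 1 := by
    rw [← mul_pow]; simp
  linear_combination (-1 : ZMod p) ^ (2 * n - 1) * h - fCoord p n x (2 * n - 1) * h2

theorem sum_fVec_apply (p n : ℕ) (b : Fin (2 * n - 1) → ZMod p) (i : Fin (2 * n)) :
    (∑ k, b k • fVec p n k) i =
      (if h : (i : ℕ) < 2 * n - 1 then b ⟨i, h⟩ else 0) +
      (if h : 0 < (i : ℕ) then b ⟨i - 1, by omega⟩ else 0) := by
  simp only [fVec, Finset.sum_apply, Pi.smul_apply, Pi.add_apply, Pi.single_apply, smul_eq_mul,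
    mul_add, Finset.sum_add_distrib, mul_ite, mul_one, mul_zero]
  congr 1
  · split_ifs with h
    · rw [Finset.sum_eq_single ⟨i, h⟩]
      · simp
      · intro k _ hk
        rw [if_neg]
        intro h'
        exact hk (Fin.ext (by simp [h']))
      · simp
    · refine Finset.sum_eq_zero fun k _ => if_neg fun h' => h ?_
      rw [h']; exact k.2
  · split_ifs with h
    · rw [Finset.sum_eq_single ⟨i - 1, by omega⟩]
      · rw [if_pos]; exact Fin.ext (by simp; omega)
      · intro k _ hk
        rw [if_neg]
        intro h'
        exact hk (Fin.ext (by simp [h']))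
      · simp
    · refine Finset.sum_eq_zero fun k _ => if_neg fun h' => h ?_
      rw [h']; simp

theorem fCoord_sum_fVec (p n : ℕ) (b : Fin (2 * n - 1) → ZMod p) (k : ℕ) (hk : k < 2 * n - 1) :
    fCoord p n (∑ k, b k • fVec p n k) k = b ⟨k, hk⟩ := by
  induction k with
  | zero =>
    have h : 0 < 2 * n := by omega
    rw [fCoord, dif_pos h, sum_fVec_apply]
    simp [hk]
  | succ k ih =>
    have h : k + 1 < 2 * n := by omega
    rw [fCoord, dif_pos h, sum_fVec_apply, ih (by omega)]
    simp [hk]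

/-- The basis `f_1, …, f_{2n-1}` of `ℤ_p^{2n-1}`. -/
noncomputable def fBasis (p n : ℕ) :
    Module.Basis (Fin (2 * n - 1)) (ZMod p) (AltSpace p n) :=
  Module.Basis.ofEquivFun
    { toFun := fun x k => fCoord p n x.1 k
      map_add' := fun x y => funext fun k => fCoord_add p n x.1 y.1 k
      map_smul' := fun r x => funext fun k => fCoord_smul p n r x.1 k
      invFun := fun b => ⟨∑ k, b k • fVec p n k,
        Submodule.sum_mem _ fun k _ => Submodule.smul_mem _ _ (fVec_mem p n k)⟩
      left_inv := by
        intro x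
        apply Subtype.ext
        funext i
        have hi := i.2
        change (∑ k : Fin (2 * n - 1), fCoord p n x.1 k • fVec p n k) i = x.1 i
        rw [sum_fVec_apply p n (fun k => fCoord p n x.1 k)]
        obtain ⟨i, hi'⟩ := i
        cases i with
        | zero =>
          have : 0 < 2 * n - 1 := by omega
          simp [fCoord, this, show 0 < n by omega]
        | succ j =>
          by_cases h : j + 1 < 2 * n - 1
          · simp [h, fCoord, hi']
          · have hl := fCoord_last p n x.1 x.2 (by omega)
            rw [show 2 * n - 1 = j + 1 by omega, fCoord, dif_pos hi'] at hl
            simp only [h, dif_neg, not_false_iff, Nat.succ_pos, dif_pos, Nat.add_sub_cancel]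
            linear_combination -hl
      right_inv := by
        intro b
        funext k
        exact fCoord_sum_fVec p n b k k.2 }

theorem fBasis_apply (p n : ℕ) (k : Fin (2 * n - 1)) : (fBasis p n k : _ → _) = fVec p n k := by
  rw [fBasis, Module.Basis.coe_ofEquivFun]
  change ∑ j, (Pi.single k (1 : ZMod p) : Fin (2 * n - 1) → ZMod p) j • fVec p n j = _
  rw [Finset.sum_eq_single k] <;> simp +contextual

/-- The matrix with entries `1` just above the diagonal, `-1` just below it, and `0` elsewhere. -/
def phiMatrix (p n : ℕ) : Matrix (Fin (2 * n - 1)) (Fin (2 * n - 1)) (ZMod p) :=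
  Matrix.of fun i j =>
    if (j : ℕ) = i + 1 then 1 else if (i : ℕ) = j + 1 then -1 else 0

/-- The skew-symmetric form `φ` on `ℤ_p^{2n-1}`, with the above matrix in the basis `f_k`. -/
noncomputable def phi (p n : ℕ) : LinearMap.BilinForm (ZMod p) (AltSpace p n) :=
  Matrix.toBilin (fBasis p n) (phiMatrix p n)

/-- The boundary coloring `e_1 + ⋯ + e_{2n}`. -/
def oneAlt (p n : ℕ) : AltSpace p n :=
  ⟨fun _ => 1, by
    change altSum p (2 * n) _ = 0
    rw [altSum_apply, Fin.sum_univ_eq_sum_range (fun i => (-1 : ZMod p) ^ i * 1) (2 * n)]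
    induction n with
    | zero => simp
    | succ n ih =>
      rw [show 2 * (n + 1) = 2 * n + 1 + 1 by ring, Finset.sum_range_succ, Finset.sum_range_succ, ih]
      simp [pow_succ]⟩

/-- The subspace `ℤ_p` of monochromatic boundary colorings. -/
def trivAlt (p n : ℕ) : Submodule (ZMod p) (AltSpace p n) :=
  Submodule.span (ZMod p) {oneAlt p n}

/-- The space `ℤ_p^{2n-2} = ℤ_p^{2n-1} / ℤ_p`. -/
abbrev SympSpace (p n : ℕ) : Type := AltSpace p n ⧸ trivAlt p n

theorem fCoord_one (p n : ℕ) (k : ℕ) (hk : k < 2 * n) :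
    fCoord p n (fun _ => 1) k = if k % 2 = 0 then 1 else 0 := by
  induction k with
  | zero => simp only [fCoord, dif_pos hk]; simp
  | succ k ih =>
    rw [fCoord, dif_pos hk, ih (by omega)]
    rcases Nat.mod_two_eq_zero_or_one k with h | h
    · rw [if_pos h, if_neg (by omega), sub_self]
    · rw [if_neg (by omega), if_pos (by omega), sub_zero]

theorem phi_apply (p n : ℕ) (x y : AltSpace p n) :
    phi p n x y = ∑ i : Fin (2 * n - 1), ∑ j : Fin (2 * n - 1),
      fCoord p n x.1 i * phiMatrix p n i j * fCoord p n y.1 j := by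
  rw [phi, Matrix.toBilin_apply]
  rfl

/-- The coloring `e_1 + ⋯ + e_{2n}` is `φ`-orthogonal to every vector. -/
theorem phi_one_right (p n : ℕ) (x : AltSpace p n) : phi p n x (oneAlt p n) = 0 := by
  rw [phi_apply]
  refine Finset.sum_eq_zero fun i _ => ?_
  have h1 : ∀ j : Fin (2 * n - 1),
      fCoord p n x.1 i * phiMatrix p n i j * fCoord p n (oneAlt p n).1 j =
      (if (j : ℕ) = i + 1 then fCoord p n x.1 i * (if (i : ℕ) % 2 = 1 then 1 else 0) else 0) -
      (if (i : ℕ) = j + 1 then fCoord p n x.1 i * (if (i : ℕ) % 2 = 1 then 1 else 0) else 0) := by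
    intro j
    have hj : fCoord p n (oneAlt p n).1 j = if (j : ℕ) % 2 = 0 then 1 else 0 :=
      fCoord_one p n j (by omega)
    rw [hj, phiMatrix, Matrix.of_apply]
    split_ifs <;> first | omega | simp
  rw [Finset.sum_congr rfl fun j _ => h1 j, Finset.sum_sub_distrib]
  by_cases hi : (i : ℕ) % 2 = 1
  · rw [Finset.sum_eq_single (⟨i + 1, by omega⟩ : Fin (2 * n - 1)),
      Finset.sum_eq_single (⟨i - 1, by omega⟩ : Fin (2 * n - 1)), if_pos rfl,
      if_pos (show (i : ℕ) = i - 1 + 1 by omega), sub_self]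
    · exact fun j _ hj => if_neg fun h => hj (Fin.ext (by simp only; omega))
    · simp
    · exact fun j _ hj => if_neg fun h => hj (Fin.ext (by simp only; omega))
    · simp
  · simp [hi]

theorem phi_skew (p n : ℕ) (x y : AltSpace p n) : phi p n y x = -phi p n x y := by
  rw [phi_apply, phi_apply, Finset.sum_comm, ← Finset.sum_neg_distrib]
  refine Finset.sum_congr rfl fun i _ => ?_
  rw [← Finset.sum_neg_distrib]
  refine Finset.sum_congr rfl fun j _ => ?_
  simp only [phiMatrix, Matrix.of_apply]
  split_ifs <;> first | omega | ring

/-- The symplectic form `φ̂` on `ℤ_p^{2n-2}` induced by `φ`. -/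
noncomputable def phiHat (p n : ℕ) : LinearMap.BilinForm (ZMod p) (SympSpace p n) :=
  (trivAlt p n).liftQ
    ((trivAlt p n).liftQ (phi p n).flip
      ((Submodule.span_singleton_le_iff_mem _ _).2
        (LinearMap.ext fun x => phi_one_right p n x))).flip
    ((Submodule.span_singleton_le_iff_mem _ _).2 (by
      refine LinearMap.ext fun y => ?_
      obtain ⟨y, rfl⟩ := Submodule.mkQ_surjective _ y
      change phi p n (oneAlt p n) y = 0
      rw [phi_skew, phi_one_right, neg_zero]))

theorem phiHat_mk (p n : ℕ) (x y : AltSpace p n) :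
    phiHat p n (Submodule.Quotient.mk x) (Submodule.Quotient.mk y) = phi p n x y := rfl

/-- Isotropic subspaces: `φ̂` vanishes on them. -/
def IsIsotropic (p n : ℕ) (W : Submodule (ZMod p) (SympSpace p n)) : Prop :=
  ∀ v ∈ W, ∀ w ∈ W, phiHat p n v w = 0

/-- Lagrangians: the maximal isotropic subspaces. -/
def IsLagrangian (p n : ℕ) (W : Submodule (ZMod p) (SympSpace p n)) : Prop :=
  Maximal (IsIsotropic p n) W

namespace TangleDiagram

/-- The map `ψ` of an `n`-tangle, with values in `ℤ_p^{2n-1}`. -/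
def psiAlt (p : ℕ) {n : ℕ} (D : TangleDiagram (2 * n)) : D.Col p →ₗ[ZMod p] AltSpace p n :=
  (D.psi p).codRestrict (AltSpace p n) (D.psi_mem p)

/-- The induced map `ψ̂ : Col_p T / ℤ_p → ℤ_p^{2n-1} / ℤ_p`. -/
def psiHat (p : ℕ) {n : ℕ} (D : TangleDiagram (2 * n)) :
    (D.Col p ⧸ D.trivCol p) →ₗ[ZMod p] SympSpace p n :=
  (D.trivCol p).mapQ (trivAlt p n) (D.psiAlt p)
    ((Submodule.span_singleton_le_iff_mem _ _).2
      (show D.psiAlt p (D.oneCol p) ∈ trivAlt p n from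
        Submodule.mem_span_singleton_self (oneAlt p n)))

/-- The boundary-coloring space `ψ̂(Col_p T / ℤ_p)` of an `n`-tangle. -/
def boundarySpace (p : ℕ) {n : ℕ} (D : TangleDiagram (2 * n)) :
    Submodule (ZMod p) (SympSpace p n) :=
  LinearMap.range (D.psiHat p)

end TangleDiagram

/-! A crossing added between neighbouring endpoints acts on boundary colorings by the transvection
`x ↦ x ± φ(x, f_k) f_k`, an isometry of `φ`. Lagrangians correspond to the subspaces `W` of
`AltSpace` with `W = W^⊥` for `φ`; every such `W` contains the constant colorings, which form the
radical.

For odd `p`, induct on the number of points. If `f = e_{2n+1} + e_{2n+2}` lies in `W`, every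
coloring in `W` has equal last two colors, and `W` is spanned by `f` and a self-polar subspace on
the first `2n` points. That subspace belongs to a rational tangle, and adding an arc on the right
realizes `W` (`RationallyRealized.of_lastPair`). Otherwise `W` contains a nonconstant coloring. Half
twists carry it to `(d, …, d, c, c)` with `c ≠ d` (`TwistRel.exists_normalForm`); subtracting the
constant `d` puts `f` into the transported subspace, and undoing the twists adds crossings to a
rational tangle. The normal form rests on the mobility of equal neighbours `c c`: they slide past
any letter and can be reflected in any other letter of the word. Two reflections translate by `2(y -
x)`, and this generates `ℤ_p` because `2` is invertible.

For `p = 2` a half twist only exchanges two colors. The boundary colorings of a tangle are the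
functions constant on the blocks of a perfect matching of the endpoints
(`TangleDiagram.exists_isMatching`). All matchings occur, since they are conjugate and neighbouring
transpositions generate the symmetric group, and distinct matchings give distinct spaces; hence the
count `(2n-1)!!`. All Lagrangians are counted by counting ordered isotropic families of size `g = n
- 1` in two ways (`natCard_isSelfPolar`). The factors satisfy `2i + 1 ≤ 2^i + 1` for `i ≥ 1`,
strictly from `i = 3` on, so for `n > 3` some Lagrangian is missed. -/

/-! ### Half twists, and boundary colorings computed slice by slice -/

/-- The half twist `x ↦ x ± (x_k - x_{k+1}) (e_k + e_{k+1})` of boundary colorings. -/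
def halfTwist {R : Type*} [CommRing R] {m : ℕ} (k : Fin (m + 1)) (s : Bool) (x : Fin (m + 2) → R) :
    Fin (m + 2) → R := fun i =>
  if i = k.castSucc then (if s then 2 * x k.castSucc - x k.succ else x k.succ)
  else if i = k.succ then (if s then x k.castSucc else 2 * x k.succ - x k.castSucc)
  else x i

/-- The boundary coloring that remains when the endpoints `k` and `k + 1` are dropped. -/
def dropPair {R : Type*} {m : ℕ} (k : Fin (m + 1)) (x : Fin (m + 2) → R) : Fin m → R :=
  fun i => x (k.castSucc.succAbove (k.succAbove i))

theorem Fin.succ_ne_castSucc_self {m : ℕ} (k : Fin m) : k.succ ≠ k.castSucc := by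
  simp [Fin.ext_iff]

theorem pairEmb_ne_castSucc {m : ℕ} (k : Fin (m + 1)) (i : Fin m) :
    k.castSucc.succAbove (k.succAbove i) ≠ k.castSucc := Fin.succAbove_ne _ _

theorem pairEmb_ne_succ {m : ℕ} (k : Fin (m + 1)) (i : Fin m) :
    k.castSucc.succAbove (k.succAbove i) ≠ k.succ := by
  intro hi
  rw [← Fin.succAbove_castSucc_self k] at hi
  exact Fin.succAbove_ne _ _ (Fin.succAbove_right_injective hi)

theorem pairEmb_injective {m : ℕ} (k : Fin (m + 1)) :
    Function.Injective fun i : Fin m => k.castSucc.succAbove (k.succAbove i) :=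
  Fin.succAbove_right_injective.comp Fin.succAbove_right_injective

theorem eq_or_eq_or_pairEmb {m : ℕ} (k : Fin (m + 1)) (j : Fin (m + 2)) :
    j = k.castSucc ∨ j = k.succ ∨ ∃ i, j = k.castSucc.succAbove (k.succAbove i) := by
  rcases Fin.eq_self_or_eq_succAbove k.castSucc j with h | ⟨l, rfl⟩
  · exact Or.inl h
  · rcases Fin.eq_self_or_eq_succAbove k l with rfl | ⟨i, rfl⟩
    · exact Or.inr (Or.inl (Fin.succAbove_castSucc_self _))
    · exact Or.inr (Or.inr ⟨i, rfl⟩)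

theorem funext_pair {R : Type*} {m : ℕ} (k : Fin (m + 1)) {x y : Fin (m + 2) → R}
    (h1 : x k.castSucc = y k.castSucc) (h2 : x k.succ = y k.succ)
    (h3 : dropPair k x = dropPair k y) : x = y := by
  funext j
  rcases eq_or_eq_or_pairEmb k j with rfl | rfl | ⟨i, rfl⟩
  · exact h1
  · exact h2
  · exact congrFun h3 i

section halfTwist

variable {R : Type*} [CommRing R] {m : ℕ} (k : Fin (m + 1))

theorem halfTwist_castSucc (s : Bool) (x : Fin (m + 2) → R) : halfTwist k s x k.castSucc =
    if s then 2 * x k.castSucc - x k.succ else x k.succ := if_pos rfl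

theorem halfTwist_succ (s : Bool) (x : Fin (m + 2) → R) : halfTwist k s x k.succ =
    if s then x k.castSucc else 2 * x k.succ - x k.castSucc :=
  (if_neg k.succ_ne_castSucc_self).trans (if_pos rfl)

theorem dropPair_halfTwist (s : Bool) (x : Fin (m + 2) → R) :
    dropPair k (halfTwist k s x) = dropPair k x := by
  funext i
  simp [dropPair, halfTwist, pairEmb_ne_succ]

theorem halfTwist_halfTwist_not (s : Bool) (x : Fin (m + 2) → R) :
    halfTwist k s (halfTwist k (!s) x) = x := by
  apply funext_pair k
  · cases s <;> simp [halfTwist_castSucc, halfTwist_succ]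
  · cases s <;> simp [halfTwist_castSucc, halfTwist_succ]
  · rw [dropPair_halfTwist, dropPair_halfTwist]

end halfTwist

namespace TangleDiagram

variable {p : ℕ}

/-- Colorings of the quotient `Arc` are unfolded into colorings of pieces that agree at the joints.
Pieces are defined by recursion on the diagram, so the slices can then be treated one at a time. -/
theorem mem_range_psi {m : ℕ} {D : TangleDiagram m} {x : Fin m → ZMod p} :
    x ∈ LinearMap.range (D.psi p) ↔ ∃ c : D.Piece → ZMod p, (∀ q ∈ D.joints, c q.1 = c q.2) ∧
      (∀ y ∈ D.pieceCrossings, c y.underArc₁ + c y.underArc₂ = 2 * c y.overArc) ∧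
      ∀ i, c (D.endPiece i) = x i := by
  constructor
  · rintro ⟨c, rfl⟩
    exact ⟨fun s => c.1 (Quot.mk _ s), fun q hq => congrArg c.1 (Quot.sound hq),
      fun y hy => c.2 (y.map (Quot.mk _)) (List.mem_map.2 ⟨y, hy, rfl⟩), fun i => rfl⟩
  · rintro ⟨c, hj, hc, hx⟩
    refine ⟨⟨Quot.lift c fun s t h => hj (s, t) h, ?_⟩, funext hx⟩
    intro y hy
    obtain ⟨z, hz, rfl⟩ := List.mem_map.1 hy
    exact hc z hz

theorem mem_range_psi_cap {m : ℕ} {D : TangleDiagram m} {k : Fin (m + 1)}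
    {x : Fin (m + 2) → ZMod p} : x ∈ LinearMap.range ((cap D k).psi p) ↔
      x k.castSucc = x k.succ ∧ dropPair k x ∈ LinearMap.range (D.psi p) := by
  have e1 : (cap D k).endPiece k.castSucc = (none : Option D.Piece) := by
    simp only [endPiece, Fin.insertNth_apply_same]
    rfl
  have e2 : (cap D k).endPiece k.succ = (none : Option D.Piece) := by
    rw [← Fin.succAbove_castSucc_self k]
    simp only [endPiece, Fin.insertNth_apply_succAbove, Fin.insertNth_apply_same]
    rfl
  have e3 : ∀ i, (cap D k).endPiece (k.castSucc.succAbove (k.succAbove i)) =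
      (some (D.endPiece i) : Option D.Piece) := by
    intro i
    simp only [endPiece, Fin.insertNth_apply_succAbove]
    rfl
  simp only [mem_range_psi]
  constructor
  · rintro ⟨c, hj, hc, hx⟩
    refine ⟨by rw [← hx, ← hx, e1, e2], fun s => c (some s), ?_, ?_, ?_⟩
    · exact fun q hq => hj (some q.1, some q.2) (List.mem_map.2 ⟨q, hq, rfl⟩)
    · exact fun y hy => hc (y.map some) (List.mem_map.2 ⟨y, hy, rfl⟩)
    · intro i
      rw [dropPair, ← hx, e3]
  · rintro ⟨h, c, hj, hc, hx⟩
    refine ⟨fun s : Option D.Piece => s.elim (x k.castSucc) c, ?_, ?_, ?_⟩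
    · intro q hq
      obtain ⟨q, hq', rfl⟩ := List.mem_map.1 hq
      exact hj q hq'
    · intro y hy
      obtain ⟨y, hy', rfl⟩ := List.mem_map.1 hy
      exact hc y hy'
    · intro i
      rcases eq_or_eq_or_pairEmb k i with rfl | rfl | ⟨i, rfl⟩
      · rw [e1]; rfl
      · rw [e2]; exact h
      · rw [e3]; exact hx i

theorem mem_range_psi_join {m : ℕ} {D : TangleDiagram (m + 2)} {k : Fin (m + 1)}
    {x : Fin m → ZMod p} : x ∈ LinearMap.range ((join D k).psi p) ↔
      ∃ y ∈ LinearMap.range (D.psi p), y k.castSucc = y k.succ ∧ dropPair k y = x := by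
  simp only [mem_range_psi]
  constructor
  · rintro ⟨c, hj, hc, hx⟩
    refine ⟨fun i => c (D.endPiece i), ⟨c, fun q hq => hj q (List.mem_cons_of_mem _ hq), hc,
      fun i => rfl⟩, hj (D.endPiece k.castSucc, D.endPiece k.succ) List.mem_cons_self, funext hx⟩
  · rintro ⟨y, ⟨c, hj, hc, hy⟩, h, rfl⟩
    refine ⟨c, ?_, hc, fun i => hy _⟩
    intro q hq
    rcases List.mem_cons.1 hq with rfl | hq
    · change c (D.endPiece k.castSucc) = c (D.endPiece k.succ)
      rw [hy, hy, h]
    · exact hj q hq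

/-- The Fox relation forces the color of the new piece to be twice the over color minus the old
under color. Thus colorings extend uniquely over the crossing and their boundary values change by
`halfTwist k s`, whose inverse is `halfTwist k (!s)`. -/
theorem mem_range_psi_cross {m : ℕ} {D : TangleDiagram (m + 2)} {k : Fin (m + 1)} {s : Bool}
    {x : Fin (m + 2) → ZMod p} : x ∈ LinearMap.range ((cross D k s).psi p) ↔
      halfTwist k (!s) x ∈ LinearMap.range (D.psi p) := by
  have hne := k.succ_ne_castSucc_self
  simp only [mem_range_psi]
  cases s with
  | true =>
    have e1 : (cross D k true).endPiece k.castSucc = (none : Option D.Piece) := if_pos rfl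
    have e2 : (cross D k true).endPiece k.succ = (some (D.endPiece k.castSucc) : Option D.Piece) :=
      (if_neg hne).trans (if_pos rfl)
    have e3 : ∀ i, (cross D k true).endPiece (k.castSucc.succAbove (k.succAbove i)) =
        (some (D.endPiece (k.castSucc.succAbove (k.succAbove i))) : Option D.Piece) := fun i =>
      (if_neg (pairEmb_ne_castSucc k i)).trans (if_neg (pairEmb_ne_succ k i))
    constructor
    · rintro ⟨c, hj, hc, hx⟩
      have h0 := hc ⟨some (D.endPiece k.castSucc), some (D.endPiece k.succ), none⟩
        List.mem_cons_self
      refine ⟨fun s => c (some s), ?_, ?_, congrFun (funext_pair k ?_ ?_ (funext fun i => ?_))⟩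
      · exact fun q hq => hj (some q.1, some q.2) (List.mem_map.2 ⟨q, hq, rfl⟩)
      · exact fun y hy => hc (y.map some) (List.mem_cons_of_mem _ (List.mem_map.2 ⟨y, hy, rfl⟩))
      · rw [halfTwist_castSucc, ← hx, ← hx, e1, e2]; rfl
      · rw [halfTwist_succ, ← hx, ← hx, e1, e2]
        simp only at h0
        simp only [Bool.not_true, Bool.false_eq_true, if_false]
        linear_combination h0
      · rw [dropPair_halfTwist, dropPair, dropPair, ← hx, e3]
    · rintro ⟨c, hj, hc, hx⟩
      have h1 := hx k.castSucc
      have h2 := hx k.succ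
      rw [halfTwist_castSucc] at h1
      rw [halfTwist_succ] at h2
      simp only [Bool.not_true, Bool.false_eq_true, if_false] at h1 h2
      refine ⟨fun s : Option D.Piece => s.elim (x k.castSucc) c, ?_, ?_,
        congrFun (funext_pair k ?_ ?_ (funext fun i => ?_))⟩
      · intro q hq
        obtain ⟨q, hq', rfl⟩ := List.mem_map.1 hq
        exact hj q hq'
      · intro y hy
        rcases List.mem_cons.1 hy with rfl | hy
        · change c _ + x k.castSucc = 2 * c _
          rw [h1, h2]; ring
        · obtain ⟨y, hy', rfl⟩ := List.mem_map.1 hy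
          exact hc y hy'
      · rw [e1]; rfl
      · rw [e2]; exact h1
      · rw [dropPair, e3, ← dropPair_halfTwist k (!true)]
        exact hx _
  | false =>
    have e1 : (cross D k false).endPiece k.castSucc = (some (D.endPiece k.succ) : Option D.Piece) :=
      if_pos rfl
    have e2 : (cross D k false).endPiece k.succ = (none : Option D.Piece) :=
      (if_neg hne).trans (if_pos rfl)
    have e3 : ∀ i, (cross D k false).endPiece (k.castSucc.succAbove (k.succAbove i)) =
        (some (D.endPiece (k.castSucc.succAbove (k.succAbove i))) : Option D.Piece) := fun i =>
      (if_neg (pairEmb_ne_castSucc k i)).trans (if_neg (pairEmb_ne_succ k i))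
    constructor
    · rintro ⟨c, hj, hc, hx⟩
      have h0 := hc ⟨some (D.endPiece k.succ), some (D.endPiece k.castSucc), none⟩
        List.mem_cons_self
      refine ⟨fun s => c (some s), ?_, ?_, congrFun (funext_pair k ?_ ?_ (funext fun i => ?_))⟩
      · exact fun q hq => hj (some q.1, some q.2) (List.mem_map.2 ⟨q, hq, rfl⟩)
      · exact fun y hy => hc (y.map some) (List.mem_cons_of_mem _ (List.mem_map.2 ⟨y, hy, rfl⟩))
      · rw [halfTwist_castSucc, ← hx, ← hx, e1, e2]
        simp only at h0
        simp only [Bool.not_false, if_true]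
        linear_combination h0
      · rw [halfTwist_succ, ← hx, ← hx, e1, e2]; rfl
      · rw [dropPair_halfTwist, dropPair, dropPair, ← hx, e3]
    · rintro ⟨c, hj, hc, hx⟩
      have h1 := hx k.castSucc
      have h2 := hx k.succ
      rw [halfTwist_castSucc] at h1
      rw [halfTwist_succ] at h2
      simp only [Bool.not_false, if_true] at h1 h2
      refine ⟨fun s : Option D.Piece => s.elim (x k.succ) c, ?_, ?_,
        congrFun (funext_pair k ?_ ?_ (funext fun i => ?_))⟩
      · intro q hq
        obtain ⟨q, hq', rfl⟩ := List.mem_map.1 hq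
        exact hj q hq'
      · intro y hy
        rcases List.mem_cons.1 hy with rfl | hy
        · change c _ + x k.succ = 2 * c _
          rw [h1, h2]; ring
        · obtain ⟨y, hy', rfl⟩ := List.mem_map.1 hy
          exact hc y hy'
      · rw [e1]; exact h2
      · rw [e2]; rfl
      · rw [dropPair, e3, ← dropPair_halfTwist k (!false)]
        exact hx _

/-- Adding an arc to the right of a rational tangle gives a tangle with the boundary colorings
of a rational tangle. -/
theorem IsRational.exists_cap_last {m : ℕ} {D : TangleDiagram m} (h : D.IsRational) :
    ∃ D' : TangleDiagram (m + 2), D'.IsRational ∧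
      LinearMap.range (D'.psi p) = LinearMap.range ((cap D (Fin.last m)).psi p) := by
  induction h with
  | @crossingless m D hcr hcl =>
    refine ⟨cap D (Fin.last m), .crossingless _ ?_ ?_, rfl⟩
    · have : D.pieceCrossings = [] := List.map_eq_nil_iff.1 hcr
      simp only [crossings, pieceCrossings, this, List.map_nil]
    · intro a
      obtain ⟨s, rfl⟩ := Quot.exists_rep a
      cases s with
      | none =>
        refine ⟨(Fin.last m).castSucc, congrArg (Quot.mk _) ?_⟩
        simp only [endPiece, Fin.insertNth_apply_same]
        rfl
      | some s =>
        obtain ⟨i, hi⟩ := hcl (Quot.mk _ s)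
        let f : D.Arc → (cap D (Fin.last m)).Arc :=
          Quot.map some fun s t hst => List.mem_map.2 ⟨(s, t), hst, rfl⟩
        refine ⟨(Fin.last m).castSucc.succAbove ((Fin.last m).succAbove i), ?_⟩
        refine Eq.trans (congrArg (Quot.mk _) ?_) (congrArg f hi)
        simp only [endPiece, Fin.insertNth_apply_succAbove]
        rfl
  | @twist m D k s h ih =>
    obtain ⟨D', hD', e⟩ := ih
    -- The new arc lies to the right of the twisted endpoints, so adding it commutes with the
    -- crossing.
    refine ⟨cross D' k.castSucc.castSucc s, .twist _ _ _ hD', ?_⟩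
    ext x
    rw [mem_range_psi_cross, e, mem_range_psi_cap, mem_range_psi_cap, mem_range_psi_cross]
    have h1 : ∀ y : Fin (m + 2 + 2) → ZMod p, dropPair (Fin.last (m + 2)) y =
        fun i => y i.castSucc.castSucc := by
      intro y
      funext i
      simp [dropPair]
    have hk := k.2
    have h2 : halfTwist k.castSucc.castSucc (!s) x (Fin.last (m + 2)).castSucc =
        x (Fin.last (m + 2)).castSucc := by
      rw [halfTwist, if_neg, if_neg] <;> simp [Fin.ext_iff] <;> omega
    have h3 : halfTwist k.castSucc.castSucc (!s) x (Fin.last (m + 2)).succ =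
        x (Fin.last (m + 2)).succ := by
      rw [halfTwist, if_neg, if_neg] <;> simp [Fin.ext_iff] <;> omega
    rw [h1, h1, h2, h3]
    have h4 : (fun i : Fin (m + 2) => halfTwist k.castSucc.castSucc (!s) x i.castSucc.castSucc) =
        halfTwist k (!s) fun i => x i.castSucc.castSucc := by
      funext i
      simp only [halfTwist, Fin.ext_iff, Fin.val_castSucc, Fin.val_succ]
      rfl
    rw [h4]

end TangleDiagram

/-! ### Words of colors up to half twists -/

theorem ZMod.two_ne_zero_of_ne_two {p : ℕ} [Fact p.Prime] (hp : p ≠ 2) : (2 : ZMod p) ≠ 0 := by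
  intro h
  have h : ((2 : ℕ) : ZMod p) = 0 := by exact_mod_cast h
  rw [ZMod.natCast_eq_zero_iff] at h
  exact hp ((Nat.prime_dvd_prime_iff_eq Fact.out Nat.prime_two).1 h)

/-- The relation on words generated by the half twists of neighbouring letters. -/
inductive TwistRel {R : Type*} [CommRing R] : List R → List R → Prop
  | refl (l : List R) : TwistRel l l
  | trans {l₁ l₂ l₃ : List R} (h : TwistRel l₁ l₂) (h' : TwistRel l₂ l₃) : TwistRel l₁ l₃
  | pos (l : List R) (a b : R) (l' : List R) :
      TwistRel (l ++ a :: b :: l') (l ++ (2 * a - b) :: a :: l')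
  | neg (l : List R) (a b : R) (l' : List R) :
      TwistRel (l ++ a :: b :: l') (l ++ b :: (2 * b - a) :: l')

/-- The alternating sum of the letters of a word. -/
def List.alternating {R : Type*} [CommRing R] : List R → R
  | [] => 0
  | a :: l => a - l.alternating

namespace TwistRel

variable {R : Type*} [CommRing R]

theorem symm {l l' : List R} (h : TwistRel l l') : TwistRel l' l := by
  induction h with
  | refl l => exact .refl l
  | trans _ _ h h' => exact h'.trans h
  | pos l a b l' =>
    have h := neg l (2 * a - b) a l'
    rwa [sub_sub_cancel] at h
  | neg l a b l' =>
    have h := pos l b (2 * b - a) l'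
    rwa [sub_sub_cancel] at h

theorem append_left (w : List R) {l l' : List R} (h : TwistRel l l') :
    TwistRel (w ++ l) (w ++ l') := by
  induction h with
  | refl l => exact .refl _
  | trans _ _ h h' => exact h.trans h'
  | pos l a b l' =>
    rw [← List.append_assoc, ← List.append_assoc]
    exact .pos _ _ _ _
  | neg l a b l' =>
    rw [← List.append_assoc, ← List.append_assoc]
    exact .neg _ _ _ _

theorem cons (a : R) {l l' : List R} (h : TwistRel l l') : TwistRel (a :: l) (a :: l') :=
  h.append_left [a]

theorem alternating_append_congr (w : List R) {l l' : List R}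
    (h : l.alternating = l'.alternating) : (w ++ l).alternating = (w ++ l').alternating := by
  induction w with
  | nil => exact h
  | cons a w ih => simp [List.alternating, ih]

/-- In both rules the difference of the two affected letters is preserved. In the normal form
argument this invariant shows that the word left after splitting off an equal pair again has
alternating sum `0`. -/
theorem alternating_eq {l l' : List R} (h : TwistRel l l') : l.alternating = l'.alternating := by
  induction h with
  | refl l => rfl
  | trans _ _ h h' => exact h.trans h'
  | pos l a b l' =>
    refine alternating_append_congr _ ?_
    simp only [List.alternating]
    ring
  | neg l a b l' =>
    refine alternating_append_congr _ ?_
    simp only [List.alternating]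
    ring

/-- Needed to exclude that a nonconstant coloring has a constant normal form. -/
theorem forall_eq {l l' : List R} (h : TwistRel l l') (d : R) (hl : ∀ x ∈ l, x = d) :
    ∀ x ∈ l', x = d := by
  induction h with
  | refl l => exact hl
  | trans _ _ h h' => exact h' (h hl)
  | pos l a b l' =>
    simp only [List.mem_append, List.mem_cons] at hl ⊢
    have ha : a = d := hl a (by simp)
    have hb : b = d := hl b (by simp)
    rintro x (hx | rfl | rfl | hx)
    · exact hl _ (by simp [hx])
    · rw [ha, hb]; ring
    · exact ha
    · exact hl _ (by simp [hx])
  | neg l a b l' =>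
    simp only [List.mem_append, List.mem_cons] at hl ⊢
    have ha : a = d := hl a (by simp)
    have hb : b = d := hl b (by simp)
    rintro x (hx | rfl | rfl | hx)
    · exact hl _ (by simp [hx])
    · exact hb
    · rw [ha, hb]; ring
    · exact hl _ (by simp [hx])

/-- Passing under the two strands colored `c`, the letter `x` is reflected in `c` twice, hence
unchanged. -/
theorem pair_swap (c x : R) (l : List R) : TwistRel (c :: c :: x :: l) (x :: c :: c :: l) := by
  have h1 := pos [c] c x l
  have h2 := pos [] c (2 * c - x) (c :: l)
  rw [sub_sub_cancel] at h2
  exact h1.trans h2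

theorem pair_move (c : R) (l l' : List R) :
    TwistRel (c :: c :: (l ++ l')) (l ++ c :: c :: l') := by
  induction l with
  | nil => exact .refl _
  | cons x l ih => exact (pair_swap c x (l ++ l')).trans (ih.cons x)

/-- Both letters of the pair pass under `x`, which reflects each of them in `x`; the pair then
returns to the front by `pair_swap`. -/
theorem pair_reflect_head (c x : R) (l : List R) :
    TwistRel (c :: c :: x :: l) ((2 * x - c) :: (2 * x - c) :: x :: l) :=
  ((neg [c] c x l).trans (neg [] c x ((2 * x - c) :: l))).trans (pair_swap (2 * x - c) x l).symm

theorem pair_reflect {x : R} {l : List R} (hx : x ∈ l) (c : R) :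
    TwistRel (c :: c :: l) ((2 * x - c) :: (2 * x - c) :: l) := by
  obtain ⟨l₁, l₂, rfl⟩ := List.append_of_mem hx
  exact ((pair_move c l₁ (x :: l₂)).trans ((pair_reflect_head c x l₂).append_left l₁)).trans
    (pair_move _ l₁ (x :: l₂)).symm

/-- The reflections in `x` and then in `y` compose to the translation by `2 * (y - x)`. For odd `p`
and `x ≠ y` this moves the pair to any color. -/
theorem pair_add_nsmul {x y : R} {l : List R} (hx : x ∈ l) (hy : y ∈ l) (c : R) (k : ℕ) :
    TwistRel (c :: c :: l) ((c + k * (2 * (y - x))) :: (c + k * (2 * (y - x))) :: l) := by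
  induction k with
  | zero => simpa using TwistRel.refl _
  | succ k ih =>
    have h := (pair_reflect hx (c + k * (2 * (y - x)))).trans (pair_reflect hy _)
    have e : 2 * y - (2 * x - (c + k * (2 * (y - x)))) = c + ((k + 1 : ℕ) : R) * (2 * (y - x)) := by
      push_cast; ring
    rw [e] at h
    exact ih.trans h

/-- The twist `(a, b) ↦ (2a - b, a)` is the translation of both letters by their difference, which
it preserves, so it can be iterated. -/
theorem add_nsmul (a b : R) (l : List R) (k : ℕ) :
    TwistRel (a :: b :: l) ((a + k * (a - b)) :: (b + k * (a - b)) :: l) := by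
  induction k with
  | zero => simpa using TwistRel.refl _
  | succ k ih =>
    have h := pos [] (a + k * (a - b)) (b + k * (a - b)) l
    have e1 : 2 * (a + k * (a - b)) - (b + k * (a - b)) = a + ((k + 1 : ℕ) : R) * (a - b) := by
      push_cast; ring
    have e2 : a + k * (a - b) = b + ((k + 1 : ℕ) : R) * (a - b) := by
      push_cast; ring
    rw [e1] at h
    nth_rewrite 2 [e2] at h
    exact ih.trans h

variable {p : ℕ} [Fact p.Prime]

theorem exists_nat_mul (d t : ZMod p) (hd : d ≠ 0) : ∃ k : ℕ, (k : ZMod p) * d = t :=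
  ⟨(t / d).val, by rw [ZMod.natCast_zmod_val, div_mul_cancel₀ _ hd]⟩

/-- If `a ≠ b`, multiples of `a - b` exhaust `ℤ_p`, so the first two letters can be translated until
the second equals `c`. The resulting pair `c c` slides to the front. -/
theorem exists_pair (a b c : ZMod p) (l : List (ZMod p)) :
    ∃ d e, TwistRel (a :: b :: c :: l) (d :: d :: e :: l) := by
  by_cases hab : a = b
  · subst hab
    exact ⟨a, c, .refl _⟩
  · obtain ⟨k, hk⟩ := exists_nat_mul (a - b) (c - b) (sub_ne_zero.2 hab)
    have h := add_nsmul a b (c :: l) k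
    rw [hk, add_sub_cancel] at h
    exact ⟨c, _, h.trans (pair_swap c _ l).symm⟩

/-- For odd `p`, words of even length with alternating sum `0` have a normal form. -/
theorem exists_normalForm (hp : p ≠ 2) (n : ℕ) (l : List (ZMod p)) (hl : l.length = 2 * n + 2)
    (hl' : l.alternating = 0) :
    ∃ c d, TwistRel l (List.replicate (2 * n) d ++ [c, c]) := by
  have h2 := ZMod.two_ne_zero_of_ne_two hp
  induction n generalizing l with
  | zero =>
    match l, hl with
    | [a, b], _ =>
      simp only [List.alternating, sub_zero, sub_eq_zero] at hl'
      subst hl'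
      exact ⟨a, a, .refl _⟩
  | succ n ih =>
    match l, hl with
    | a :: b :: c :: l, hl =>
      obtain ⟨d, e, h⟩ := exists_pair a b c l
      have h' := h.alternating_eq
      rw [hl'] at h'
      obtain ⟨c', d', ih⟩ := ih (e :: l) (by simp at hl ⊢; omega) (by
        simp only [List.alternating, sub_sub_cancel] at h' ⊢
        exact h'.symm)
      have h3 := h.trans ((ih.cons d).cons d)
      -- For `n = 0` the rest is just `[c', c']`, so the word is already normal; moreover `d'` does
      -- not occur in it and could not serve as a reflecting letter below.
      by_cases hn : n = 0
      · subst hn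
        exact ⟨c', d, h3⟩
      -- If the rest is constant, the pair `d d` moves to the right end and becomes the exceptional
      -- pair. Otherwise the rest has two distinct letters, and translations by `2 * (c' - d')`
      -- recolor the pair to `d'`.
      by_cases hc : c' = d'
      · subst hc
        refine ⟨d, c', h3.trans ?_⟩
        have h4 := pair_move d (List.replicate (2 * n) c' ++ [c', c']) []
        rw [List.append_nil] at h4
        have e : List.replicate (2 * (n + 1)) c' = List.replicate (2 * n) c' ++ [c', c'] := by
          rw [mul_add, List.replicate_add]; rfl
        rwa [e]
      · obtain ⟨k, hk⟩ := exists_nat_mul (2 * (c' - d')) (d' - d)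
          (mul_ne_zero h2 (sub_ne_zero.2 hc))
        have h4 := pair_add_nsmul (x := d') (y := c')
          (l := List.replicate (2 * n) d' ++ [c', c']) (by simp [hn]) (by simp) d k
        rw [hk, add_sub_cancel] at h4
        exact ⟨c', d', h3.trans h4⟩

end TwistRel

/-- Twists of words come from half twists of boundary colorings. -/
theorem TwistRel.exists_halfTwist {R : Type*} [CommRing R] {m : ℕ} {l l' : List R}
    (h : TwistRel l l') (x : Fin (m + 2) → R) (hx : List.ofFn x = l) :
    ∃ y, List.ofFn y = l' ∧
      Relation.ReflTransGen (fun u v => ∃ k s, v = halfTwist (m := m) k s u) x y := by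
  have key : ∀ (w : List R) (a b : R) (w' : List R) (x : Fin (m + 2) → R) (s : Bool),
      List.ofFn x = w ++ a :: b :: w' → ∃ k, List.ofFn (halfTwist (m := m) k s x) =
        w ++ (if s then 2 * a - b else b) :: (if s then a else 2 * b - a) :: w' := by
    intro w a b w' x s hx
    have hlen : m + 2 = w.length + (w'.length + 2) := by
      simpa using congrArg List.length hx
    have hget : ∀ (i : ℕ) (hi : i < m + 2), x ⟨i, hi⟩ = (w ++ a :: b :: w')[i]'(by
        simp; omega) := by
      intro i hi
      simp only [← hx, List.getElem_ofFn]
    refine ⟨⟨w.length, by omega⟩, List.ext_getElem (by simp; omega) fun i h1 h2 => ?_⟩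
    have ha := hget w.length (by omega)
    have hb := hget (w.length + 1) (by omega)
    have hi := hget i (by rwa [List.length_ofFn] at h1)
    simp only [List.getElem_ofFn, halfTwist, Fin.ext_iff, Fin.castSucc_mk, Fin.succ_mk, ha, hb, hi]
    grind
  induction h generalizing x with
  | refl l => exact ⟨x, hx, .refl⟩
  | trans _ _ h h' =>
    obtain ⟨y, hy, h⟩ := h x hx
    obtain ⟨z, hz, h'⟩ := h' y hy
    exact ⟨z, hz, h.trans h'⟩
  | pos w a b w' =>
    obtain ⟨k, hk⟩ := key w a b w' x true hx
    exact ⟨_, hk, .single ⟨k, true, rfl⟩⟩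
  | neg w a b w' =>
    obtain ⟨k, hk⟩ := key w a b w' x false hx
    exact ⟨_, hk, .single ⟨k, false, rfl⟩⟩

/-! ### Lagrangians as self-polar spaces of boundary colorings -/

/-- Submodules that coincide with their (left) orthogonal complement. -/
def IsSelfPolar {R M : Type*} [CommRing R] [AddCommGroup M] [Module R M]
    (B : LinearMap.BilinForm R M) (W : Submodule R M) : Prop :=
  ∀ x, x ∈ W ↔ ∀ y ∈ W, B x y = 0

/-- This formula turns half twists into transvections along `f_k`, and shows that only constant
colorings are orthogonal to everything. It is checked on the basis. -/
theorem phi_fBasis_right (p n : ℕ) (x : AltSpace p n) (k : Fin (2 * n - 1)) :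
    phi p n x (fBasis p n k) = x.1 ⟨k, by omega⟩ - x.1 ⟨k + 1, by omega⟩ := by
  have h : (phi p n).flip (fBasis p n k) =
      (LinearMap.proj (R := ZMod p) (φ := fun _ => ZMod p) (⟨k, by omega⟩ : Fin (2 * n)) -
        LinearMap.proj (⟨k + 1, by omega⟩ : Fin (2 * n))) ∘ₗ (AltSpace p n).subtype := by
    refine (fBasis p n).ext fun i => ?_
    have h1 : (phi p n).flip (fBasis p n k) (fBasis p n i) = phiMatrix p n i k := by
      change phi p n (fBasis p n i) (fBasis p n k) = _
      rw [← LinearMap.BilinForm.toMatrix_apply, phi, LinearMap.BilinForm.toMatrix_toBilin]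
    rw [h1]
    simp only [LinearMap.comp_apply, Submodule.subtype_apply, LinearMap.sub_apply,
      LinearMap.proj_apply, fBasis_apply, fVec, Pi.add_apply, Pi.single_apply, Fin.mk.injEq,
      phiMatrix, Matrix.of_apply]
    split_ifs <;> first | omega | simp
  exact LinearMap.congr_fun h x

theorem phi_one_left (p n : ℕ) (x : AltSpace p n) : phi p n (oneAlt p n) x = 0 := by
  rw [phi_skew, phi_one_right, neg_zero]

/-- For `p = 2` the form `φ` is the dot product. -/
theorem phi_two (n : ℕ) (x y : AltSpace 2 n) : phi 2 n x y = x.1 ⬝ᵥ y.1 := by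
  have h : phi 2 n x = (dotProductBilin (ZMod 2) (ZMod 2) x.1) ∘ₗ (AltSpace 2 n).subtype := by
    refine (fBasis 2 n).ext fun k => ?_
    rw [phi_fBasis_right, LinearMap.comp_apply, Submodule.subtype_apply, fBasis_apply, fVec]
    change _ = x.1 ⬝ᵥ _
    rw [dotProduct_add, dotProduct_single_one, dotProduct_single_one, CharTwo.sub_eq_add]
  exact LinearMap.congr_fun h y

/-- Skew-symmetry suffices only for odd `p`. For `p = 2`, `a * a = a` turns the dot square of `x`
into its alternating sum, signs being immaterial. -/
theorem phi_self (p n : ℕ) [Fact p.Prime] (x : AltSpace p n) : phi p n x x = 0 := by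
  by_cases hp : p = 2
  · subst hp
    have hx : altSum 2 (2 * n) x.1 = 0 := x.2
    rw [altSum_apply] at hx
    rw [phi_two, dotProduct, ← hx]
    refine Finset.sum_congr rfl fun i _ => ?_
    rw [CharTwo.neg_eq, one_pow, one_mul]
    generalize x.1 i = a
    revert a
    decide
  · have h := phi_skew p n x x
    have h' : 2 * phi p n x x = 0 := by linear_combination h
    exact (mul_eq_zero.1 h').resolve_left (ZMod.two_ne_zero_of_ne_two hp)

theorem phiHat_skew (p n : ℕ) (x y : SympSpace p n) : phiHat p n y x = -phiHat p n x y := by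
  obtain ⟨x, rfl⟩ := Submodule.Quotient.mk_surjective _ x
  obtain ⟨y, rfl⟩ := Submodule.Quotient.mk_surjective _ y
  rw [phiHat_mk, phiHat_mk, phi_skew]

theorem phiHat_self (p n : ℕ) [Fact p.Prime] (x : SympSpace p n) : phiHat p n x x = 0 := by
  obtain ⟨x, rfl⟩ := Submodule.Quotient.mk_surjective _ x
  rw [phiHat_mk, phi_self]

/-- Since `φ̂` is alternating, a vector orthogonal to an isotropic `L` can be adjoined without
losing isotropy, so maximality puts it into `L`. -/
theorem isLagrangian_iff_phiHat {p n : ℕ} [Fact p.Prime]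
    {L : Submodule (ZMod p) (SympSpace p n)} :
    IsLagrangian p n L ↔ IsSelfPolar (phiHat p n) L := by
  constructor
  · intro h x
    refine ⟨fun hx y hy => h.1 x hx y hy, fun hx => ?_⟩
    have hiso : IsIsotropic p n (L ⊔ Submodule.span (ZMod p) {x}) := by
      intro v hv w hw
      obtain ⟨a, ha, b, hb, rfl⟩ := Submodule.mem_sup.1 hv
      obtain ⟨c, hc, d, hd, rfl⟩ := Submodule.mem_sup.1 hw
      obtain ⟨r, rfl⟩ := Submodule.mem_span_singleton.1 hb
      obtain ⟨t, rfl⟩ := Submodule.mem_span_singleton.1 hd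
      simp [h.1 a ha c hc, hx c hc, phiHat_self, phiHat_skew p n x a, hx a ha]
    exact h.2 hiso le_sup_left (le_sup_right (a := L) (Submodule.mem_span_singleton_self x))
  · intro h
    refine ⟨fun v hv w hw => (h v).1 hv w hw, fun W hW hL v hv => (h v).2 fun w hw => ?_⟩
    exact hW v hv w (hL hw)

/-- Passing to preimages removes the quotient: the constant colorings are orthogonal to everything
and so belong to every self-polar subspace. -/
theorem isLagrangian_iff_phi {p n : ℕ} [Fact p.Prime] {L : Submodule (ZMod p) (SympSpace p n)} :
    IsLagrangian p n L ↔ IsSelfPolar (phi p n) (L.comap (trivAlt p n).mkQ) := by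
  rw [isLagrangian_iff_phiHat]
  constructor
  · intro h x
    rw [Submodule.mem_comap, h]
    refine ⟨fun hx y hy => hx _ hy, fun hx y hy => ?_⟩
    obtain ⟨y, rfl⟩ := Submodule.Quotient.mk_surjective _ y
    exact hx y hy
  · intro h x
    obtain ⟨x, rfl⟩ := Submodule.Quotient.mk_surjective _ x
    refine (h x).trans ⟨fun hx y hy => ?_, fun hx y hy => hx _ hy⟩
    obtain ⟨y, rfl⟩ := Submodule.Quotient.mk_surjective _ y
    exact hx y hy

namespace TangleDiagram

theorem mem_range_psiAlt {p n : ℕ} {D : TangleDiagram (2 * n)} {x : AltSpace p n} :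
    x ∈ LinearMap.range (D.psiAlt p) ↔ x.1 ∈ LinearMap.range (D.psi p) := by
  simp only [LinearMap.mem_range, psiAlt, Subtype.ext_iff, LinearMap.codRestrict_apply]

/-- The boundary space determines, and is determined by, the boundary colorings. -/
theorem comap_boundarySpace (p : ℕ) {n : ℕ} (D : TangleDiagram (2 * n)) :
    (D.boundarySpace p).comap (trivAlt p n).mkQ = LinearMap.range (D.psiAlt p) := by
  ext x
  constructor
  · rintro ⟨c, hc⟩
    obtain ⟨c, rfl⟩ := Submodule.Quotient.mk_surjective _ c
    have hc : (Submodule.Quotient.mk (D.psiAlt p c) : SympSpace p n) = Submodule.Quotient.mk x := hc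
    rw [Submodule.Quotient.eq] at hc
    obtain ⟨t, ht⟩ := Submodule.mem_span_singleton.1 hc
    refine ⟨c - t • D.oneCol p, ?_⟩
    rw [map_sub, map_smul]
    change _ - t • oneAlt p n = x
    rw [ht, sub_sub_cancel]
  · rintro ⟨c, rfl⟩
    exact ⟨Submodule.Quotient.mk c, rfl⟩

end TangleDiagram

/-! ### Odd `p`: realization by rational tangles -/

/-- The half twist as a transvection of the space of boundary colorings. -/
noncomputable def twistAlt (p n : ℕ) (k : Fin (2 * n + 1)) (s : Bool) :
    AltSpace p (n + 1) →ₗ[ZMod p] AltSpace p (n + 1) :=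
  LinearMap.id + (if s then (1 : ZMod p) else -1) •
    ((phi p (n + 1)).flip (fBasis p (n + 1) k)).smulRight (fBasis p (n + 1) k)

theorem twistAlt_apply (p n : ℕ) (k : Fin (2 * n + 1)) (s : Bool) (x : AltSpace p (n + 1)) :
    twistAlt p n k s x = x + (if s then (1 : ZMod p) else -1) •
      (phi p (n + 1) x (fBasis p (n + 1) k) • fBasis p (n + 1) k) := rfl

theorem coe_twistAlt (p n : ℕ) (k : Fin (2 * n + 1)) (s : Bool) (x : AltSpace p (n + 1)) :
    (twistAlt p n k s x).1 = halfTwist (m := 2 * n) k s x.1 := by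
  rw [twistAlt_apply, phi_fBasis_right, Submodule.coe_add, Submodule.coe_smul, Submodule.coe_smul,
    fBasis_apply]
  have h0 := k.succ_ne_castSucc_self
  have hv : ∀ i : Fin (2 * n + 2), fVec p (n + 1) k i =
      (if i = k.castSucc then 1 else 0) + (if i = k.succ then 1 else 0) := by
    intro i
    simp only [fVec, Pi.add_apply, Pi.single_apply]
    rfl
  have hk1 : x.1 ⟨k, by omega⟩ = x.1 (k.castSucc : Fin (2 * n + 2)) := rfl
  have hk2 : x.1 ⟨k + 1, by omega⟩ = x.1 (k.succ : Fin (2 * n + 2)) := rfl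
  rw [hk1, hk2]
  refine funext_pair k ?_ ?_ ?_
  · rw [halfTwist_castSucc]
    simp only [Pi.add_apply, Pi.smul_apply, hv, smul_eq_mul, if_pos, if_neg h0.symm]
    cases s <;> simp <;> ring
  · rw [halfTwist_succ]
    simp only [Pi.add_apply, Pi.smul_apply, hv, smul_eq_mul, if_pos, if_neg h0]
    cases s <;> simp <;> ring
  · rw [dropPair_halfTwist]
    funext i
    simp only [dropPair, Pi.add_apply, Pi.smul_apply, hv, smul_eq_mul,
      if_neg (pairEmb_ne_castSucc k i), if_neg (pairEmb_ne_succ k i)]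
    simp

theorem twistAlt_twistAlt_not (p n : ℕ) (k : Fin (2 * n + 1)) (s : Bool)
    (x : AltSpace p (n + 1)) : twistAlt p n k s (twistAlt p n k (!s) x) = x := by
  apply Subtype.ext
  rw [coe_twistAlt, coe_twistAlt]
  exact halfTwist_halfTwist_not (m := 2 * n) k s x.1

/-- With `φ(f_k, f_k) = 0`, the two remaining correction terms cancel by skew-symmetry. -/
theorem phi_twistAlt (p n : ℕ) (k : Fin (2 * n + 1)) (s : Bool) (x y : AltSpace p (n + 1)) :
    phi p (n + 1) (twistAlt p n k s x) (twistAlt p n k s y) = phi p (n + 1) x y := by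
  have h : phi p (n + 1) (fBasis p (n + 1) k) (fBasis p (n + 1) k) = 0 := by
    rw [phi, ← LinearMap.BilinForm.toMatrix_apply, LinearMap.BilinForm.toMatrix_toBilin]
    simp [phiMatrix]
  simp only [twistAlt_apply, map_add, map_smul, LinearMap.add_apply, LinearMap.smul_apply,
    smul_eq_mul, h, phi_skew p (n + 1) y (fBasis p (n + 1) k)]
  ring

theorem IsSelfPolar.comap_twistAlt {p n : ℕ} {W : Submodule (ZMod p) (AltSpace p (n + 1))}
    (h : IsSelfPolar (phi p (n + 1)) W) (k : Fin (2 * n + 1)) (s : Bool) :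
    IsSelfPolar (phi p (n + 1)) (W.comap (twistAlt p n k s)) := by
  intro x
  rw [Submodule.mem_comap, h]
  constructor
  · intro hx y hy
    rw [← phi_twistAlt p n k s]
    exact hx _ hy
  · intro hx y hy
    rw [← twistAlt_twistAlt_not p n k s y, phi_twistAlt]
    refine hx _ ?_
    rwa [Submodule.mem_comap, twistAlt_twistAlt_not]

/-- The sets of boundary colorings of rational tangles. -/
def RationallyRealized (p n : ℕ) (W : Submodule (ZMod p) (AltSpace p n)) : Prop :=
  ∃ T : TangleDiagram (2 * n), T.IsRational ∧ LinearMap.range (T.psiAlt p) = W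

-- One more crossing carries the boundary colorings of a tangle to their image under the half twist,
-- which here is `W`.
open TangleDiagram in
theorem RationallyRealized.of_comap_twistAlt {p n : ℕ}
    {W : Submodule (ZMod p) (AltSpace p (n + 1))} {k : Fin (2 * n + 1)} {s : Bool}
    (h : RationallyRealized p (n + 1) (W.comap (twistAlt p n k s))) :
    RationallyRealized p (n + 1) W := by
  obtain ⟨T, hT, e⟩ := h
  refine ⟨TangleDiagram.cross (m := 2 * n) T k s, .twist (m := 2 * n) T k s hT, ?_⟩
  ext x
  have h1 : x ∈ LinearMap.range
      (psiAlt p (n := n + 1) (TangleDiagram.cross (m := 2 * n) T k s)) ↔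
      halfTwist (m := 2 * n) k (!s) x.1 ∈ LinearMap.range (T.psi p) :=
    mem_range_psiAlt.trans (mem_range_psi_cross (m := 2 * n))
  rw [h1, ← coe_twistAlt, ← mem_range_psiAlt, e, Submodule.mem_comap, twistAlt_twistAlt_not]

/-- The subspace is transported along with one of its vectors; hence the claim at `v'` is required
for all self-polar subspaces, and `W` is generalized in the induction. -/
theorem RationallyRealized.of_reflTransGen {p n : ℕ} {v v' : Fin (2 * n + 2) → ZMod p}
    (h : Relation.ReflTransGen (fun u v => ∃ k s, v = halfTwist (m := 2 * n) k s u) v v')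
    (hv' : ∀ W : Submodule (ZMod p) (AltSpace p (n + 1)), IsSelfPolar (phi p (n + 1)) W →
      (∃ x ∈ W, x.1 = v') → RationallyRealized p (n + 1) W)
    (W : Submodule (ZMod p) (AltSpace p (n + 1))) (hW : IsSelfPolar (phi p (n + 1)) W)
    (hv : ∃ x ∈ W, x.1 = v) : RationallyRealized p (n + 1) W := by
  induction h using Relation.ReflTransGen.head_induction_on generalizing W with
  | refl => exact hv' W hW hv
  | head h _ ih =>
    obtain ⟨k, s, rfl⟩ := h
    obtain ⟨x, hx, rfl⟩ := hv
    -- The preimage under the twist of sign `!s` is the image under the twist of sign `s`, so it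
    -- contains the twisted vector.
    refine .of_comap_twistAlt (k := k) (s := !s) (ih _ (hW.comap_twistAlt k (!s))
      ⟨twistAlt p n k s x, ?_, coe_twistAlt p n k s x⟩)
    have h := twistAlt_twistAlt_not p n k (!s) x
    rw [Bool.not_not] at h
    rwa [Submodule.mem_comap, h]

/-- Adding two endpoints of color `0` on the right. -/
def extendAlt (p n : ℕ) : AltSpace p n →ₗ[ZMod p] AltSpace p (n + 1) :=
  LinearMap.codRestrict (AltSpace p (n + 1))
    { toFun := fun x i => if h : (i : ℕ) < 2 * n then x.1 ⟨i, h⟩ else 0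
      map_add' := fun x y => by
        funext i
        by_cases h : (i : ℕ) < 2 * n <;> simp [h]
      map_smul' := fun r x => by
        funext i
        by_cases h : (i : ℕ) < 2 * n <;> simp [h] }
    (fun x => by
      change altSum p (2 * n + 2) (fun i => if h : (i : ℕ) < 2 * n then x.1 ⟨i, h⟩ else 0) = 0
      have hx : altSum p (2 * n) x.1 = 0 := x.2
      rw [altSum_split p (Fin.last (2 * n))]
      have e : (Fin.last (2 * n)).removeNth ((Fin.last (2 * n)).castSucc.removeNth
          fun i => if h : (i : ℕ) < 2 * n then x.1 ⟨i, h⟩ else 0) = x.1 := by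
        funext i
        simp [Fin.removeNth_apply]
      rw [e, hx]
      simp)

theorem extendAlt_apply (p n : ℕ) (x : AltSpace p n) (i : Fin (2 * (n + 1))) :
    (extendAlt p n x).1 i = if h : (i : ℕ) < 2 * n then x.1 ⟨i, h⟩ else 0 := rfl

theorem phi_extendAlt (p n : ℕ) (x y : AltSpace p n) :
    phi p (n + 1) (extendAlt p n x) (extendAlt p n y) = phi p n x y := by
  have h : (phi p (n + 1) (extendAlt p n x)) ∘ₗ extendAlt p n = phi p n x := by
    refine (fBasis p n).ext fun k => ?_
    have e : extendAlt p n (fBasis p n k) = fBasis p (n + 1) ⟨k, by omega⟩ := by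
      apply Subtype.ext
      funext i
      rw [extendAlt_apply, fBasis_apply, fBasis_apply]
      simp only [fVec, Pi.add_apply, Pi.single_apply, Fin.ext_iff]
      have := k.2
      split_ifs <;> first | omega | simp
    rw [LinearMap.comp_apply, e, phi_fBasis_right, phi_fBasis_right, extendAlt_apply,
      extendAlt_apply, dif_pos, dif_pos]
  exact LinearMap.congr_fun h y

/-- The boundary coloring `e_{2n+1} + e_{2n+2}`. -/
noncomputable def lastPair (p n : ℕ) : AltSpace p (n + 1) :=
  fBasis p (n + 1) (Fin.last (2 * n) : Fin (2 * n + 1))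

theorem lastPair_apply (p n : ℕ) (i : Fin (2 * (n + 1))) :
    (lastPair p n).1 i = if (i : ℕ) < 2 * n then 0 else 1 := by
  rw [lastPair, fBasis_apply]
  simp only [fVec, Pi.add_apply, Pi.single_apply, Fin.ext_iff]
  have : ((Fin.last (2 * n) : Fin (2 * n + 1)) : ℕ) = 2 * n := rfl
  simp only [this]
  split_ifs <;> first | omega | simp

theorem phi_lastPair (p n : ℕ) (x : AltSpace p (n + 1)) : phi p (n + 1) x (lastPair p n) =
    x.1 ((Fin.last (2 * n)).castSucc : Fin (2 * n + 2)) -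
      x.1 ((Fin.last (2 * n)).succ : Fin (2 * n + 2)) :=
  phi_fBasis_right p (n + 1) x _

theorem dropPair_last {R : Type*} {m : ℕ} (x : Fin (m + 2) → R) :
    dropPair (Fin.last m) x = fun i => x i.castSucc.castSucc := by
  funext i
  simp [dropPair]

theorem exists_extendAlt {p n : ℕ} (x : AltSpace p (n + 1))
    (hx : x.1 ((Fin.last (2 * n)).castSucc : Fin (2 * n + 2)) =
      x.1 ((Fin.last (2 * n)).succ : Fin (2 * n + 2))) :
    ∃ (y : AltSpace p n) (c : ZMod p), x = extendAlt p n y + c • lastPair p n ∧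
      y.1 = dropPair (m := 2 * n) (Fin.last (2 * n)) x.1 := by
  have hx' : altSum p (2 * n + 2) x.1 = 0 := x.2
  rw [altSum_split p (Fin.last (2 * n)), hx, sub_self, mul_zero, zero_add] at hx'
  refine ⟨⟨dropPair (m := 2 * n) (Fin.last (2 * n)) x.1, hx'⟩, x.1 (Fin.last (2 * n + 1)), ?_, rfl⟩
  apply Subtype.ext
  funext i
  rw [Submodule.coe_add, Submodule.coe_smul, Pi.add_apply, Pi.smul_apply, extendAlt_apply,
    lastPair_apply]
  simp only [dropPair_last]
  by_cases hi : (i : ℕ) < 2 * n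
  · simp [hi]
  · rw [dif_neg hi, if_neg hi, zero_add, smul_eq_mul, mul_one]
    have hi' : (i : ℕ) = 2 * n ∨ (i : ℕ) = 2 * n + 1 := by omega
    rcases hi' with hi' | hi'
    · exact (congrArg x.1 (Fin.ext hi')).trans hx
    · exact congrArg x.1 (Fin.ext hi')

-- This is symplectic reduction: `W` lies in the orthogonal complement of `lastPair`, and modulo
-- `lastPair` it becomes a self-polar subspace for the first `2n` points. An arc joining the last
-- two points puts `lastPair` back.
open TangleDiagram in
theorem RationallyRealized.of_lastPair {p n : ℕ}
    (ih : ∀ W, IsSelfPolar (phi p n) W → RationallyRealized p n W)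
    {W : Submodule (ZMod p) (AltSpace p (n + 1))} (hW : IsSelfPolar (phi p (n + 1)) W)
    (hl : lastPair p n ∈ W) : RationallyRealized p (n + 1) W := by
  have hcol : ∀ y ∈ W, y.1 ((Fin.last (2 * n)).castSucc : Fin (2 * n + 2)) =
      y.1 ((Fin.last (2 * n)).succ : Fin (2 * n + 2)) := by
    intro y hy
    rw [← sub_eq_zero, ← phi_lastPair]
    exact (hW y).1 hy _ hl
  have hmem : ∀ y c, extendAlt p n y + c • lastPair p n ∈ W ↔ extendAlt p n y ∈ W := fun y c =>
    Submodule.add_mem_iff_left _ (W.smul_mem c hl)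
  have hself : IsSelfPolar (phi p n) (W.comap (extendAlt p n)) := by
    intro u
    rw [Submodule.mem_comap]
    constructor
    · intro hu w hw
      rw [← phi_extendAlt]
      exact (hW _).1 hu _ hw
    · refine fun hu => (hW _).2 fun y hy => ?_
      obtain ⟨w, c, rfl, -⟩ := exists_extendAlt y (hcol y hy)
      rw [map_add, map_smul, phi_extendAlt, hu w ((hmem w c).1 hy), phi_lastPair, extendAlt_apply,
        extendAlt_apply]
      simp
  obtain ⟨T, hT, e⟩ := ih _ hself
  obtain ⟨T', hT', e'⟩ := hT.exists_cap_last (p := p)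
  refine ⟨T', hT', ?_⟩
  ext x
  refine mem_range_psiAlt.trans ?_
  refine (iff_of_eq (congrArg (x.1 ∈ ·) e')).trans (mem_range_psi_cap.trans ?_)
  constructor
  · rintro ⟨h1, h2⟩
    obtain ⟨y, c, rfl, hy⟩ := exists_extendAlt x h1
    rw [← hy, ← mem_range_psiAlt, e] at h2
    exact (hmem y c).2 h2
  · intro hx
    refine ⟨hcol x hx, ?_⟩
    obtain ⟨y, c, rfl, hy⟩ := exists_extendAlt x (hcol x hx)
    rw [← hy, ← mem_range_psiAlt, e]
    exact (hmem y c).1 hx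

theorem altSum_eq_alternating (p m : ℕ) (x : Fin m → ZMod p) :
    altSum p m x = (List.ofFn x).alternating := by
  induction m with
  | zero => simp [altSum, List.alternating]
  | succ m ih =>
    rw [List.ofFn_succ, List.alternating, ← ih, altSum_apply, altSum_apply, Fin.sum_univ_succ,
      sub_eq_add_neg, ← Finset.sum_neg_distrib]
    simp [pow_succ]

theorem IsSelfPolar.rationallyRealized {p : ℕ} [Fact p.Prime] (hp : p ≠ 2) (n : ℕ)
    (W : Submodule (ZMod p) (AltSpace p n)) (hW : IsSelfPolar (phi p n) W) :
    RationallyRealized p n W := by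
  induction n with
  | zero =>
    have hsub : Subsingleton (AltSpace p 0) :=
      ⟨fun a b => Subtype.ext (funext fun i => i.elim0)⟩
    refine ⟨TangleDiagram.empty, .crossingless _ rfl ?_, Subsingleton.elim _ _⟩
    intro a
    obtain ⟨s, rfl⟩ := Quot.exists_rep a
    exact (s : Empty).elim
  | succ n ih =>
    by_cases hv : ∃ v ∈ W, ¬ ∃ d, ∀ i, v.1 i = d
    · obtain ⟨v, hvW, hv⟩ := hv
      have halt : (List.ofFn v.1).alternating = 0 := by
        rw [← altSum_eq_alternating]; exact v.2
      obtain ⟨c, d, h⟩ := TwistRel.exists_normalForm hp n (List.ofFn v.1) (by simp) halt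
      -- With `c = d` the normal form, and hence `v`, would be constant.
      have hcd : c - d ≠ 0 := by
        intro hcd
        refine hv ⟨d, fun i => h.symm.forall_eq d ?_ _ (List.mem_ofFn.2 ⟨i, rfl⟩)⟩
        intro x hx
        simp only [sub_eq_zero.1 hcd, List.mem_append, List.mem_replicate, List.mem_cons,
          List.not_mem_nil, or_false, or_self] at hx
        exact hx.elim And.right id
      obtain ⟨v', hv', hr⟩ := h.exists_halfTwist (m := 2 * n) v.1 rfl
      refine .of_reflTransGen hr (fun W' hW' hx => ?_) W hW ⟨v, hvW, rfl⟩
      obtain ⟨x, hx, hxv⟩ := hx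
      refine .of_lastPair ih hW' ?_
      have hx' : x = d • oneAlt p (n + 1) + (c - d) • lastPair p n := by
        apply Subtype.ext
        funext i
        have hi : x.1 i = (List.replicate (2 * n) d ++ [c, c])[(i : ℕ)]'(by simp; omega) := by
          simp only [← hv', List.getElem_ofFn, hxv]
          rfl
        have h1 : (oneAlt p (n + 1)).1 i = 1 := rfl
        rw [hi, Submodule.coe_add, Submodule.coe_smul, Submodule.coe_smul, Pi.add_apply,
          Pi.smul_apply, Pi.smul_apply, lastPair_apply, h1]
        by_cases hi : (i : ℕ) < 2 * n
        · simp [hi]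
        · have : (i : ℕ) = 2 * n ∨ (i : ℕ) = 2 * n + 1 := by omega
          rcases this with h | h <;> simp [h]
      have hone' : oneAlt p (n + 1) ∈ W' := (hW' _).2 fun y _ => phi_one_left p _ y
      have h1 : (c - d) • lastPair p n ∈ W' := by
        rw [← add_sub_cancel_left (d • oneAlt p (n + 1)) ((c - d) • lastPair p n), ← hx']
        exact W'.sub_mem hx (W'.smul_mem _ hone')
      exact (Submodule.smul_mem_iff _ hcd).1 h1
    -- If all colorings in `W` are constant, `lastPair` is orthogonal to `W` and therefore lies in
    -- it.
    · push Not at hv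
      refine .of_lastPair ih hW ((hW _).2 fun y hy => ?_)
      obtain ⟨d, hd⟩ := hv y hy
      rw [phi_skew, phi_lastPair, hd, hd, sub_self, neg_zero]

theorem IsLagrangian.exists_rational {p n : ℕ} [Fact p.Prime] (hp : p ≠ 2)
    {L : Submodule (ZMod p) (SympSpace p n)} (hL : IsLagrangian p n L) :
    ∃ T : TangleDiagram (2 * n), T.IsRational ∧ T.boundarySpace p = L := by
  obtain ⟨T, hT, h⟩ := (isLagrangian_iff_phi.1 hL).rationallyRealized hp
  refine ⟨T, hT, Submodule.comap_injective_of_surjective (Submodule.mkQ_surjective _) ?_⟩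
  rw [T.comap_boundarySpace, h]

/-! ### `p = 2`: tangles and perfect matchings -/

/-- Perfect matchings, as involutions without fixed points. -/
def Equiv.Perm.IsMatching {α : Type*} (σ : Equiv.Perm α) : Prop :=
  (∀ i, σ (σ i) = i) ∧ ∀ i, σ i ≠ i

theorem Equiv.Perm.IsMatching.conj {α : Type*} {σ : Equiv.Perm α} (h : σ.IsMatching)
    (τ : Equiv.Perm α) : (τ * σ * τ⁻¹).IsMatching := by
  refine ⟨fun i => by simp [h.1], fun i hi => h.2 (τ⁻¹ i) ?_⟩
  rw [Equiv.Perm.mul_apply, Equiv.Perm.mul_apply] at hi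
  exact (Equiv.Perm.eq_inv_iff_eq).2 hi

/-- The colorings that are constant on the blocks of a matching. -/
def matchingSpace {m : ℕ} (σ : Equiv.Perm (Fin m)) : Submodule (ZMod 2) (Fin m → ZMod 2) where
  carrier := {x | ∀ i, x (σ i) = x i}
  zero_mem' := fun _ => rfl
  add_mem' := fun ha hb i => congrArg₂ (· + ·) (ha i) (hb i)
  smul_mem' := fun r _ ha i => congrArg (r * ·) (ha i)

theorem mem_matchingSpace {m : ℕ} {σ : Equiv.Perm (Fin m)} {x : Fin m → ZMod 2} :
    x ∈ matchingSpace σ ↔ ∀ i, x (σ i) = x i := Iff.rfl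

theorem mem_matchingSpace_conj {m : ℕ} {σ τ : Equiv.Perm (Fin m)} {x : Fin m → ZMod 2} :
    x ∈ matchingSpace (τ * σ * τ⁻¹) ↔ x ∘ τ ∈ matchingSpace σ := by
  rw [mem_matchingSpace, mem_matchingSpace, ← τ.forall_congr_right]
  simp

theorem single_add_single_mem {m : ℕ} {σ : Equiv.Perm (Fin m)} (h : σ.IsMatching) (i : Fin m) :
    (Pi.single i 1 + Pi.single (σ i) 1 : Fin m → ZMod 2) ∈ matchingSpace σ := by
  intro j
  have h1 : σ j = i ↔ j = σ i := ⟨fun e => by rw [← e, h.1], fun e => by rw [e, h.1]⟩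
  simp only [Pi.add_apply, Pi.single_apply, h1, σ.injective.eq_iff]
  exact add_comm _ _

/-- The indicator of a block `{i, σ i}` lies in the space of `τ` only if `τ` preserves that block,
which forces `τ i = σ i`. -/
theorem matchingSpace_injOn {m : ℕ} : Set.InjOn (matchingSpace (m := m)) {σ | σ.IsMatching} := by
  intro σ hσ τ hτ h
  ext i : 1
  have h1 := single_add_single_mem hσ i
  rw [h] at h1
  have h2 := h1 i
  simp only [Pi.add_apply, Pi.single_apply, hτ.2 i, (hσ.2 i).symm, if_true, if_false, zero_add,
    add_zero] at h2
  by_contra hne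
  rw [if_neg (Ne.symm hne)] at h2
  exact zero_ne_one h2

/-- Modulo 2, reflections are trivial: `2a - b = b`, so the sign of the crossing is lost. -/
theorem halfTwist_two {m : ℕ} (k : Fin (m + 1)) (s : Bool) (x : Fin (m + 2) → ZMod 2) :
    halfTwist k s x = x ∘ Equiv.swap k.castSucc k.succ := by
  have h2 : (2 : ZMod 2) = 0 := rfl
  refine funext_pair k ?_ ?_ (funext fun i => ?_)
  · cases s <;> simp [halfTwist_castSucc, h2]
  · cases s <;> simp [halfTwist_succ, h2]
  · rw [dropPair_halfTwist, dropPair, dropPair, Function.comp_apply,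
      Equiv.swap_apply_of_ne_of_ne (pairEmb_ne_castSucc k i) (pairEmb_ne_succ k i)]

theorem comp_swap_eq_self {α β : Type*} [DecidableEq α] {y : α → β} {b c : α} (h : y b = y c) :
    y ∘ Equiv.swap b c = y := by
  funext j
  rw [Function.comp_apply, Equiv.swap_apply_def]
  split_ifs with h1 h2
  · rw [h1, h]
  · rw [h2, h]
  · rfl

namespace TangleDiagram

theorem mem_range_psi_two_cross {m : ℕ} {D : TangleDiagram (m + 2)} {k : Fin (m + 1)} {s : Bool}
    {σ : Equiv.Perm (Fin (m + 2))} (h : LinearMap.range (D.psi 2) = matchingSpace σ) :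
    LinearMap.range ((cross D k s).psi 2) = matchingSpace
      (Equiv.swap k.castSucc k.succ * σ * (Equiv.swap k.castSucc k.succ)⁻¹) := by
  ext x
  rw [mem_range_psi_cross, h, halfTwist_two, mem_matchingSpace_conj]

/-- The `2`-colorings of a tangle are the maps that are constant on its components. -/
theorem exists_isMatching {m : ℕ} (D : TangleDiagram m) :
    ∃ σ : Equiv.Perm (Fin m), σ.IsMatching ∧ LinearMap.range (D.psi 2) = matchingSpace σ := by
  induction D with
  | empty =>
    exact ⟨1, ⟨fun i => i.elim0, fun i => i.elim0⟩, Subsingleton.elim _ _⟩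
  | @cap m D k ih =>
    obtain ⟨σ, hσ, e⟩ := ih
    let f : Fin (m + 2) → Fin (m + 2) := k.castSucc.insertNth (α := fun _ => Fin (m + 2)) k.succ
      (k.insertNth (α := fun _ => Fin (m + 2)) k.castSucc
        fun i => k.castSucc.succAbove (k.succAbove (σ i)))
    have f1 : f k.castSucc = k.succ := by
      simp only [f, Fin.insertNth_apply_same]
    have f2 : f k.succ = k.castSucc := by
      rw [← Fin.succAbove_castSucc_self k]
      simp only [f, Fin.insertNth_apply_succAbove, Fin.insertNth_apply_same]
    have f3 : ∀ i, f (k.castSucc.succAbove (k.succAbove i)) =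
        k.castSucc.succAbove (k.succAbove (σ i)) := by
      intro i
      simp only [f, Fin.insertNth_apply_succAbove]
    have hf : Function.Involutive f := by
      intro j
      rcases eq_or_eq_or_pairEmb k j with rfl | rfl | ⟨i, rfl⟩
      · rw [f1, f2]
      · rw [f2, f1]
      · rw [f3, f3, hσ.1]
    refine ⟨hf.toPerm, ⟨hf, fun j => ?_⟩, ?_⟩
    · rw [Function.Involutive.coe_toPerm]
      rcases eq_or_eq_or_pairEmb k j with rfl | rfl | ⟨i, rfl⟩
      · rw [f1]; exact k.succ_ne_castSucc_self
      · rw [f2]; exact k.succ_ne_castSucc_self.symm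
      · rw [f3]; exact fun h => hσ.2 i (pairEmb_injective k h)
    · ext x
      rw [mem_range_psi_cap, e, mem_matchingSpace, mem_matchingSpace,
        Function.Involutive.coe_toPerm]
      constructor
      · rintro ⟨h1, h2⟩ j
        rcases eq_or_eq_or_pairEmb k j with rfl | rfl | ⟨i, rfl⟩
        · rw [f1, h1]
        · rw [f2, h1]
        · rw [f3]; exact h2 i
      · refine fun h => ⟨by rw [← h k.succ, f2], fun i => ?_⟩
        rw [dropPair, dropPair, ← f3]
        exact h _
  | @join m D k ih =>
    obtain ⟨σ₀, hσ₀, e⟩ := ih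
    set a : Fin (m + 2) := k.castSucc with ha
    set b : Fin (m + 2) := k.succ with hb
    set c : Fin (m + 2) := σ₀ a with hc
    have hab : b ≠ a := k.succ_ne_castSucc_self
    have hca : c ≠ a := hσ₀.2 a
    -- Exchanging the labels `b` and `c` makes `{a, b}` a block and, if `c ≠ b`, pairs `c` with the
    -- old partner of `b`. Deleting `{a, b}` leaves the matching of the joined tangle. On colorings
    -- with equal values at `b` and `c` the exchange does nothing.
    let σ := Equiv.swap b c * σ₀ * (Equiv.swap b c)⁻¹
    have hσ : σ.IsMatching := hσ₀.conj _
    have sb : σ b = a := by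
      simp only [σ, Equiv.Perm.mul_apply, Equiv.swap_inv, Equiv.swap_apply_left]
      rw [hc, hσ₀.1, ← hc, Equiv.swap_apply_of_ne_of_ne hab.symm hca.symm]
    have sa : σ a = b := by rw [← sb, hσ.1]
    have hemb : ∀ i : Fin m, ∃ j : Fin m,
        σ (k.castSucc.succAbove (k.succAbove i)) = k.castSucc.succAbove (k.succAbove j) := by
      intro i
      rcases eq_or_eq_or_pairEmb k (σ (k.castSucc.succAbove (k.succAbove i))) with h | h | h
      · exact absurd (σ.injective (h.trans sb.symm)) (pairEmb_ne_succ k i)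
      · exact absurd (σ.injective (h.trans sa.symm)) (pairEmb_ne_castSucc k i)
      · exact h
    choose f hf using hemb
    have hinv : Function.Involutive f := by
      intro i
      apply pairEmb_injective k
      simp only
      rw [← hf, ← hf, hσ.1]
    refine ⟨hinv.toPerm, ⟨hinv, fun j hj => ?_⟩, ?_⟩
    · rw [Function.Involutive.coe_toPerm] at hj
      have := hf j
      rw [hj] at this
      exact hσ.2 _ this
    · ext x
      rw [mem_range_psi_join, e, mem_matchingSpace, Function.Involutive.coe_toPerm]
      constructor
      · rintro ⟨y, hy, h, rfl⟩ i
        have hyc : y ∘ Equiv.swap b c = y := comp_swap_eq_self (by rw [hc, hy a, h])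
        have hy' : y ∈ matchingSpace σ := by
          rw [mem_matchingSpace_conj, hyc]; exact hy
        rw [dropPair, dropPair, ← hf]
        exact hy' _
      · intro hx
        have hy : ∀ t, ∃ y : Fin (m + 2) → ZMod 2, y a = t ∧ y b = t ∧ dropPair k y = x := by
          intro t
          refine ⟨a.insertNth (α := fun _ => ZMod 2) t (k.insertNth (α := fun _ => ZMod 2) t x),
            ?_, ?_, ?_⟩
          · simp only [Fin.insertNth_apply_same]
          · rw [hb, ← Fin.succAbove_castSucc_self k, ← ha]
            simp only [Fin.insertNth_apply_succAbove, Fin.insertNth_apply_same]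
          · funext i
            rw [dropPair, ← ha]
            simp only [Fin.insertNth_apply_succAbove]
        have hmem : ∀ y : Fin (m + 2) → ZMod 2, y a = y b → dropPair k y = x →
            y ∈ matchingSpace σ := by
          intro y h1 h2 j
          rcases eq_or_eq_or_pairEmb k j with rfl | rfl | ⟨i, rfl⟩
          · rw [← ha, sa, h1]
          · rw [← hb, sb, h1]
          · rw [hf]
            have := hx i
            rw [← h2] at this
            exact this
        -- `t` is the color to be given to `a` and `b`: that of the surviving endpoint `c`. If `c =
        -- b`, the join closes a component, whose color is free, and `0` is taken.
        obtain ⟨t, ht⟩ : ∃ t, ∀ y : Fin (m + 2) → ZMod 2, y a = t → y b = t →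
            dropPair k y = x → y c = t := by
          rcases eq_or_eq_or_pairEmb k c with h | h | ⟨i, h⟩
          · exact absurd h hca
          · exact ⟨0, fun y _ h2 _ => by rw [h, ← hb, h2]⟩
          · exact ⟨x i, fun y _ _ h3 => by rw [h, ← h3, dropPair]⟩
        obtain ⟨y, h1, h2, h3⟩ := hy t
        refine ⟨y, ?_, h1.trans h2.symm, h3⟩
        have hyσ := hmem y (h1.trans h2.symm) h3
        have hyc : y ∘ Equiv.swap b c = y := comp_swap_eq_self (by rw [h2, ht y h1 h2 h3])
        rw [mem_matchingSpace_conj, hyc] at hyσ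
        exact hyσ
  | @cross m D k s ih =>
    obtain ⟨σ, hσ, e⟩ := ih
    exact ⟨_, hσ.conj _, mem_range_psi_two_cross e⟩

/-- The diagram of `n` adjacent arcs. -/
def arcs : (n : ℕ) → TangleDiagram (2 * n)
  | 0 => empty
  | n + 1 => cap (arcs n) 0

end TangleDiagram

/-- Matchings thus form a single conjugacy class, which serves both to count them and to realize
them all. -/
theorem Equiv.Perm.IsMatching.cycleType_eq {n : ℕ} {σ : Equiv.Perm (Fin (2 * n))} :
    σ.IsMatching ↔ σ.cycleType = Multiset.replicate n 2 := by
  have hsq : (∀ i, σ (σ i) = i) ↔ σ ^ 2 = 1 := by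
    rw [Equiv.ext_iff, pow_two]
    rfl
  rw [Equiv.Perm.IsMatching, hsq]
  constructor
  · rintro ⟨h1, h2⟩
    have h3 := Equiv.Perm.cycleType_of_pow_prime_eq_one h1
    have h4 := σ.sum_cycleType
    have h5 : σ.support = Finset.univ := by
      ext i
      simp [h2 i]
    rw [h5, h3, Multiset.sum_replicate, Finset.card_univ, Fintype.card_fin, smul_eq_mul] at h4
    rw [h3, show Multiset.card σ.cycleType = n by omega]
  · intro h
    refine ⟨Equiv.Perm.pow_prime_eq_one_iff.2 fun c hc => ?_, fun i => ?_⟩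
    · rw [h] at hc
      exact Multiset.eq_of_mem_replicate hc
    · have h4 := σ.sum_cycleType
      rw [h, Multiset.sum_replicate, smul_eq_mul, mul_comm] at h4
      have h5 : σ.support = Finset.univ := by
        rw [← Finset.card_eq_iff_eq_univ, ← h4, Fintype.card_fin]
      rw [← Equiv.Perm.mem_support, h5]
      exact Finset.mem_univ i

/-- The size of the conjugacy class times `2^n n! = (2n)!!` is `(2n)! = (2n)!! (2n-1)!!`. -/
theorem ncard_isMatching (n : ℕ) (hn : 1 ≤ n) :
    {σ : Equiv.Perm (Fin (2 * n)) | σ.IsMatching}.ncard = ∏ i ∈ Finset.Icc 1 (n - 1), (2 * i + 1) := by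
  obtain ⟨k, rfl⟩ := Nat.exists_eq_add_of_le' hn
  have h1 : {σ : Equiv.Perm (Fin (2 * (k + 1))) | σ.IsMatching} =
      (({g | g.cycleType = Multiset.replicate (k + 1) 2} :
        Finset (Equiv.Perm (Fin (2 * (k + 1))))) : Set _) := by
    ext σ
    simp only [Set.mem_ofPred_eq, Equiv.Perm.IsMatching.cycleType_eq, Finset.coe_filter,
      Finset.mem_univ, true_and]
  have h2 := Equiv.Perm.card_of_cycleType_mul_eq (Fin (2 * (k + 1)))
    (Multiset.replicate (k + 1) 2)
  rw [if_pos ⟨by simp only [Multiset.sum_replicate, Fintype.card_fin, smul_eq_mul, mul_comm,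
    le_refl], fun a ha => (Multiset.eq_of_mem_replicate ha).ge⟩] at h2
  have h3 : (Multiset.replicate (k + 1) 2).toFinset = {2} := by
    rw [Multiset.toFinset_replicate, if_neg (by omega)]
  have h4 := Nat.factorial_eq_mul_doubleFactorial (2 * k + 1)
  rw [show 2 * k + 1 + 1 = 2 * (k + 1) by ring, Nat.doubleFactorial_two_mul,
    Nat.doubleFactorial_eq_prod_odd] at h4
  rw [h3, Finset.prod_singleton, Multiset.count_replicate_self, Multiset.prod_replicate,
    Multiset.sum_replicate, Fintype.card_fin, smul_eq_mul, mul_comm (k + 1) 2, Nat.sub_self,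
    Nat.factorial_zero, one_mul, h4, mul_comm] at h2
  rw [h1, Set.ncard_coe_finset, Nat.eq_of_mul_eq_mul_left (by positivity) h2, Nat.add_sub_cancel]
  rw [Finset.range_eq_Ico, Finset.prod_Ico_add' (fun i => 2 * i + 1) 0 k 1]
  rfl

open TangleDiagram in
/-- Every matching is the boundary pattern of a tangle. -/
theorem Equiv.Perm.IsMatching.exists_tangle {n : ℕ} {σ : Equiv.Perm (Fin (2 * n))}
    (hσ : σ.IsMatching) :
    ∃ T : TangleDiagram (2 * n), LinearMap.range (T.psi 2) = matchingSpace σ := by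
  obtain ⟨σ₀, hσ₀, e⟩ := (arcs n).exists_isMatching
  have hconj : IsConj σ₀ σ := by
    rw [Equiv.Perm.isConj_iff_cycleType_eq, cycleType_eq.1 hσ₀, cycleType_eq.1 hσ]
  obtain ⟨τ, rfl⟩ := isConj_iff.1 hconj
  clear hconj hσ
  cases n with
  | zero => exact ⟨arcs 0, Subsingleton.elim (α := Submodule (ZMod 2) (Fin 0 → ZMod 2)) _ _⟩
  | succ n =>
    -- Writing `τ` as a product of neighbouring transpositions, each factor is produced by one
    -- crossing, of arbitrary sign.
    have hτ : τ ∈ Submonoid.closure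
        (Set.range fun i : Fin (2 * n + 1) => Equiv.swap i.castSucc i.succ) := by
      rw [Equiv.Perm.mclosure_swap_castSucc_succ]
      trivial
    induction hτ using Submonoid.closure_induction_left with
    | one => exact ⟨arcs (n + 1), by simpa using e⟩
    | mul_left s hs τ _ ih =>
      obtain ⟨k, rfl⟩ := hs
      obtain ⟨T, hT⟩ := ih
      refine ⟨cross (m := 2 * n) T k true, ?_⟩
      refine (mem_range_psi_two_cross (m := 2 * n) hT).trans ?_
      simp only [mul_assoc, mul_inv_rev]

namespace TangleDiagram

theorem range_range_psi_two (n : ℕ) :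
    (Set.range fun T : TangleDiagram (2 * n) => LinearMap.range (T.psi 2)) =
      matchingSpace '' {σ | σ.IsMatching} := by
  ext W
  constructor
  · rintro ⟨T, rfl⟩
    obtain ⟨σ, hσ, h⟩ := T.exists_isMatching
    exact ⟨σ, hσ, h.symm⟩
  · rintro ⟨σ, hσ, rfl⟩
    exact Equiv.Perm.IsMatching.exists_tangle hσ

theorem ncard_range_psi_two (n : ℕ) (hn : 1 ≤ n) :
    (Set.range fun T : TangleDiagram (2 * n) => LinearMap.range (T.psi 2)).ncard =
      ∏ i ∈ Finset.Icc 1 (n - 1), (2 * i + 1) := by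
  rw [range_range_psi_two, matchingSpace_injOn.ncard_image, ncard_isMatching n hn]

/-- In the dot product of two block-constant vectors the terms of each block cancel in pairs.
Conversely, orthogonality to `e_i + e_{σ i}` says that `x` is constant on the block of `i`. -/
theorem isLagrangian_boundarySpace_two {n : ℕ} (T : TangleDiagram (2 * n)) :
    IsLagrangian 2 n (T.boundarySpace 2) := by
  rw [isLagrangian_iff_phi, comap_boundarySpace]
  obtain ⟨σ, hσ, e⟩ := T.exists_isMatching
  intro x
  simp only [mem_range_psiAlt, e, phi_two]
  constructor
  · intro hx y hy
    refine Finset.sum_involution (fun i _ => σ i) (fun i _ => ?_) (fun i _ _ => hσ.2 i)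
      (fun i _ => Finset.mem_univ _) fun i _ => hσ.1 i
    rw [hx i, hy i, CharTwo.add_self_eq_zero]
  · intro hx i
    have hmem := single_add_single_mem hσ i
    have halt : (Pi.single i 1 + Pi.single (σ i) 1 : Fin (2 * n) → ZMod 2) ∈ AltSpace 2 n := by
      rw [← e] at hmem
      obtain ⟨c, hc⟩ := hmem
      rw [← hc]
      exact T.psi_mem 2 c
    have h := hx ⟨_, halt⟩ hmem
    rw [dotProduct_add, dotProduct_single_one, dotProduct_single_one] at h
    exact (CharTwo.add_eq_zero.1 h).symm

/-- Pulling back from the quotient and including into `ℤ_2^{2n}` is injective on subspaces and takes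
the boundary space to the range of `psi`, so the two counts agree. -/
theorem ncard_boundarySpace_two (n : ℕ) (hn : 1 ≤ n) :
    {L : Submodule (ZMod 2) (SympSpace 2 n) | IsLagrangian 2 n L ∧
      ∃ T : TangleDiagram (2 * n), T.boundarySpace 2 = L}.ncard =
      ∏ i ∈ Finset.Icc 1 (n - 1), (2 * i + 1) := by
  have hinj : Function.Injective fun L : Submodule (ZMod 2) (SympSpace 2 n) =>
      (L.comap (trivAlt 2 n).mkQ).map (AltSpace 2 n).subtype :=
    (Submodule.map_injective_of_injective (AltSpace 2 n).subtype_injective).comp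
      (Submodule.comap_injective_of_surjective (Submodule.mkQ_surjective _))
  have hmap : ∀ T : TangleDiagram (2 * n), ((T.boundarySpace 2).comap (trivAlt 2 n).mkQ).map
      (AltSpace 2 n).subtype = LinearMap.range (T.psi 2) := by
    intro T
    rw [comap_boundarySpace, ← LinearMap.range_comp]
    rfl
  rw [← ncard_range_psi_two n hn, ← Set.ncard_image_of_injective _ hinj]
  congr 1
  ext W
  constructor
  · rintro ⟨L, ⟨-, T, rfl⟩, rfl⟩
    exact ⟨T, (hmap T).symm⟩
  · rintro ⟨T, rfl⟩
    exact ⟨T.boundarySpace 2, ⟨T.isLagrangian_boundarySpace_two, T, rfl⟩, hmap T⟩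

end TangleDiagram

/-! ### The number of Lagrangians over a finite field -/

section LagrangianCount

open Module

variable {K V : Type*} [Field K] [AddCommGroup V] [Module K V] {B : LinearMap.BilinForm K V}

/-- Linearly independent families spanning isotropic subspaces. -/
def IsotropicFamily (B : LinearMap.BilinForm K V) (k : ℕ) : Type _ :=
  {s : Fin k → V // LinearIndependent K s ∧ ∀ i j, B (s i) (s j) = 0}

theorem span_le_orthogonal {ι : Type*} {s : ι → V} (h : ∀ i j, B (s i) (s j) = 0) :
    Submodule.span K (Set.range s) ≤ B.orthogonal (Submodule.span K (Set.range s)) := by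
  have h1 : ∀ i, ∀ y ∈ Submodule.span K (Set.range s), B y (s i) = 0 := by
    intro i y hy
    induction hy using Submodule.span_induction with
    | mem y hy => obtain ⟨j, rfl⟩ := hy; exact h j i
    | zero => simp
    | add y z _ _ hy hz => simp [hy, hz]
    | smul r y _ hy => simp [hy]
  rw [Submodule.span_le]
  rintro _ ⟨i, rfl⟩
  exact fun y hy => h1 i y hy

/-- Isotropic families are built by adding vectors of the orthogonal complement. -/
noncomputable def isotropicFamilySuccEquiv (hB : B.IsAlt) (k : ℕ) :
    IsotropicFamily B (k + 1) ≃ Σ s : IsotropicFamily B k,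
      ↥((B.orthogonal (Submodule.span K (Set.range s.1)) : Set V) \
        Submodule.span K (Set.range s.1)) where
  toFun s := ⟨⟨Fin.tail s.1, (linearIndependent_finSucc.1 s.2.1).1, fun i j => s.2.2 _ _⟩, s.1 0, by
    refine ⟨?_, (linearIndependent_finSucc.1 s.2.1).2⟩
    intro y hy
    change B y (s.1 0) = 0
    induction hy using Submodule.span_induction with
    | mem y hy => obtain ⟨j, rfl⟩ := hy; exact s.2.2 _ _
    | zero => simp
    | add y z _ _ hy hz => simp [hy, hz]
    | smul r y _ hy => simp [hy]⟩
  invFun s := ⟨Fin.cons s.2.1 s.1.1, linearIndependent_finCons.2 ⟨s.1.2.1, s.2.2.2⟩, by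
    have h : ∀ i, B (s.1.1 i) s.2.1 = 0 := fun i =>
      s.2.2.1 _ (Submodule.subset_span ⟨i, rfl⟩)
    intro i j
    refine Fin.cases ?_ (fun i => ?_) i <;> refine Fin.cases ?_ (fun j => ?_) j
    · exact hB _
    · exact hB.isRefl _ _ (h j)
    · exact h i
    · exact s.1.2.2 i j⟩
  left_inv s := Subtype.ext (Fin.cons_self_tail _)
  right_inv s := rfl

theorem IsSelfPolar.orthogonal_eq (hB : B.IsAlt) {L : Submodule K V} (h : IsSelfPolar B L) :
    B.orthogonal L = L := by
  ext x
  rw [h x]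
  exact ⟨fun hx y hy => hB.isRefl _ _ (hx y hy), fun hx y hy => hB.isRefl _ _ (hx y hy)⟩

theorem isSelfPolar_of_orthogonal_eq (hB : B.IsAlt) {L : Submodule K V} (h : B.orthogonal L = L) :
    IsSelfPolar B L := by
  intro x
  conv_lhs => rw [← h]
  exact ⟨fun hx y hy => hB.isRefl _ _ (hx y hy), fun hx y hy => hB.isRefl _ _ (hx y hy)⟩

variable [Finite V] {g : ℕ}

/-- If `k` vectors spanning `U` are chosen, the next one ranges over `U^⊥ \ U`, where `U ≤ U^⊥` have
dimensions `k` and `2g - k`. -/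
theorem natCard_isotropicFamily (hB : B.IsAlt) (hB' : B.Nondegenerate)
    (hg : finrank K V = 2 * g) (k : ℕ) (hk : k ≤ g) :
    Nat.card (IsotropicFamily B k) = ∏ i ∈ Finset.range k,
      (Nat.card K ^ (2 * g - i) - Nat.card K ^ i) := by
  induction k with
  | zero =>
    have : Unique (IsotropicFamily B 0) :=
      { default := ⟨Fin.elim0, linearIndependent_empty_type, fun i => i.elim0⟩
        uniq := fun s => Subtype.ext (Subsingleton.elim _ _) }
    rw [Nat.card_unique, Finset.prod_range_zero]
  | succ k ih =>
    have : Finite (IsotropicFamily B k) := Subtype.finite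
    have := Fintype.ofFinite (IsotropicFamily B k)
    have hc : ∀ s : IsotropicFamily B k,
        Nat.card ↥((B.orthogonal (Submodule.span K (Set.range s.1)) : Set V) \
          Submodule.span K (Set.range s.1)) = Nat.card K ^ (2 * g - k) - Nat.card K ^ k := by
      intro s
      have h1 : finrank K (Submodule.span K (Set.range s.1)) = k := by
        rw [finrank_span_eq_card s.2.1, Fintype.card_fin]
      have h2 := LinearMap.BilinForm.finrank_orthogonal hB' (Submodule.span K (Set.range s.1))
      rw [h1, hg] at h2
      rw [Nat.card_coe_set_eq, Set.ncard_sdiff (span_le_orthogonal s.2.2), ← Nat.card_coe_set_eq,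
        ← Nat.card_coe_set_eq]
      have h3 := Module.natCard_eq_pow_finrank (K := K)
        (V := B.orthogonal (Submodule.span K (Set.range s.1)))
      have h4 := Module.natCard_eq_pow_finrank (K := K) (V := Submodule.span K (Set.range s.1))
      rw [h2] at h3
      rw [h1] at h4
      exact congrArg₂ (· - ·) h3 h4
    rw [Nat.card_congr (isotropicFamilySuccEquiv hB k), Nat.card_sigma,
      Finset.sum_congr rfl fun s _ => hc s, Finset.sum_const, Finset.card_univ,
      ← Nat.card_eq_fintype_card, ih (by omega), Finset.prod_range_succ, smul_eq_mul]

theorem IsSelfPolar.finrank_eq (hB : B.IsAlt) (hB' : B.Nondegenerate)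
    (hg : finrank K V = 2 * g) {L : Submodule K V} (h : IsSelfPolar B L) : finrank K L = g := by
  have h1 := LinearMap.BilinForm.finrank_orthogonal hB' L
  rw [h.orthogonal_eq hB, hg] at h1
  have h2 := L.finrank_le
  omega

variable [Fintype K]

/-- An ordered basis of a Lagrangian is a maximal isotropic family. -/
theorem natCard_isotropicFamily_top (hB : B.IsAlt) (hB' : B.Nondegenerate)
    (hg : finrank K V = 2 * g) :
    Nat.card (IsotropicFamily B g) = Nat.card {L : Submodule K V // IsSelfPolar B L} *
      ∏ i ∈ Finset.range g, (Nat.card K ^ g - Nat.card K ^ i) := by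
  let f : (Σ L : {L : Submodule K V // IsSelfPolar B L},
      {s : Fin g → L.1 // LinearIndependent K s}) → IsotropicFamily B g := fun x =>
    ⟨fun i => (x.2.1 i : V), x.2.2.map' x.1.1.subtype (Submodule.ker_subtype _),
      fun i j => (x.1.2 _).1 (x.2.1 i).2 _ (x.2.1 j).2⟩
  have hspan : ∀ x, Submodule.span K (Set.range (f x).1) = x.1.1 := by
    intro x
    refine Submodule.eq_of_le_of_finrank_eq ?_ ?_
    · rw [Submodule.span_le]
      rintro _ ⟨i, rfl⟩
      exact (x.2.1 i).2
    · rw [finrank_span_eq_card (f x).2.1, Fintype.card_fin, x.1.2.finrank_eq hB hB' hg]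
  have hf : Function.Bijective f := by
    constructor
    · rintro ⟨⟨L, hL⟩, s⟩ ⟨⟨L', hL'⟩, s'⟩ h
      have h1 := hspan ⟨⟨L, hL⟩, s⟩
      rw [h, hspan] at h1
      simp only at h1
      subst h1
      have h2 : s = s' := by
        apply Subtype.ext
        funext i
        exact Subtype.ext (congrFun (congrArg Subtype.val h) i)
      rw [h2]
    · intro s
      have h1 : finrank K (Submodule.span K (Set.range s.1)) = g := by
        rw [finrank_span_eq_card s.2.1, Fintype.card_fin]
      have h2 := LinearMap.BilinForm.finrank_orthogonal hB' (Submodule.span K (Set.range s.1))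
      -- The span has dimension `g`, as does its orthogonal complement, which contains it; so they
      -- coincide.
      have h3 : IsSelfPolar B (Submodule.span K (Set.range s.1)) := by
        refine isSelfPolar_of_orthogonal_eq hB (Submodule.eq_of_le_of_finrank_eq
          (span_le_orthogonal s.2.2) ?_).symm
        rw [h2, h1, hg]
        omega
      exact ⟨⟨⟨_, h3⟩, fun i => ⟨s.1 i, Submodule.subset_span ⟨i, rfl⟩⟩,
        LinearIndependent.of_comp (Submodule.subtype _) s.2.1⟩, rfl⟩
  have := Fintype.ofFinite {L : Submodule K V // IsSelfPolar B L}
  have hc : ∀ L : {L : Submodule K V // IsSelfPolar B L},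
      Nat.card {s : Fin g → L.1 // LinearIndependent K s} =
        ∏ i ∈ Finset.range g, (Nat.card K ^ g - Nat.card K ^ i) := by
    intro L
    have h := L.2.finrank_eq hB hB' hg
    rw [card_linearIndependent h.ge, h, ← Nat.card_eq_fintype_card,
      Finset.prod_range fun i => Nat.card K ^ g - Nat.card K ^ i]
  rw [← Nat.card_congr (Equiv.ofBijective f hf), Nat.card_sigma,
    Finset.sum_congr rfl fun L _ => hc L, Finset.sum_const, Finset.card_univ,
    ← Nat.card_eq_fintype_card, smul_eq_mul]

/-- The number of Lagrangians of a symplectic space over a finite field. -/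
theorem natCard_isSelfPolar (hB : B.IsAlt) (hB' : B.Nondegenerate) (hg : finrank K V = 2 * g) :
    Nat.card {L : Submodule K V // IsSelfPolar B L} =
      ∏ i ∈ Finset.Icc 1 g, (Nat.card K ^ i + 1) := by
  have hq : 1 < Nat.card K := Finite.one_lt_card
  have h := natCard_isotropicFamily_top hB hB' hg
  rw [natCard_isotropicFamily hB hB' hg g le_rfl] at h
  -- This factorization exhibits the number of ordered bases of a Lagrangian as a factor of the
  -- number of isotropic families, ready to be cancelled.
  have hfac : ∀ i ∈ Finset.range g, Nat.card K ^ (2 * g - i) - Nat.card K ^ i =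
      (Nat.card K ^ (g - i) + 1) * (Nat.card K ^ g - Nat.card K ^ i) := by
    intro i hi
    have hi := Finset.mem_range.1 hi
    have e1 : Nat.card K ^ (2 * g - i) = Nat.card K ^ (g - i) * Nat.card K ^ g := by
      rw [← pow_add]; congr 1; omega
    have e2 : Nat.card K ^ g = Nat.card K ^ (g - i) * Nat.card K ^ i := by
      rw [← pow_add]; congr 1; omega
    rw [add_mul, Nat.mul_sub, ← e1, ← e2, one_mul]
    have h1 : Nat.card K ^ g ≤ Nat.card K ^ (2 * g - i) := Nat.pow_le_pow_right hq.le (by omega)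
    have h2 : Nat.card K ^ i ≤ Nat.card K ^ g := Nat.pow_le_pow_right hq.le (by omega)
    omega
  rw [Finset.prod_congr rfl hfac, Finset.prod_mul_distrib] at h
  have hpos : 0 < ∏ i ∈ Finset.range g, (Nat.card K ^ g - Nat.card K ^ i) :=
    Finset.prod_pos fun i hi => Nat.sub_pos_of_lt (Nat.pow_lt_pow_right hq (Finset.mem_range.1 hi))
  rw [← Nat.eq_of_mul_eq_mul_right hpos h,
    ← Finset.prod_range_reflect (fun i => Nat.card K ^ (g - i) + 1), Finset.range_eq_Ico]
  change _ = ∏ i ∈ Finset.Ico 1 (g + 1), _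
  rw [← Finset.prod_Ico_add' (fun i => Nat.card K ^ i + 1) 0 g 1]
  refine Finset.prod_congr rfl fun i hi => ?_
  have := (Finset.mem_Ico.1 hi).2
  rw [show g - (g - 1 - i) = i + 1 by omega]

end LagrangianCount

/-- Pairing with `f_k` compares the neighbouring colors `k` and `k + 1`, so a vector orthogonal to
all `f_k` is constant, hence zero in the quotient. -/
theorem phiHat_nondegenerate (p n : ℕ) [Fact p.Prime] : (phiHat p n).Nondegenerate := by
  have key : ∀ x : SympSpace p n, (∀ y, phiHat p n x y = 0) → x = 0 := by
    intro x hx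
    obtain ⟨x, rfl⟩ := Submodule.Quotient.mk_surjective _ x
    rw [Submodule.Quotient.mk_eq_zero]
    have hstep : ∀ (i : ℕ) (hi : i < 2 * n), x.1 ⟨i, hi⟩ = x.1 ⟨0, by omega⟩ := by
      intro i hi
      induction i with
      | zero => rfl
      | succ i ih =>
        rw [← ih (by omega)]
        have h := hx (Submodule.Quotient.mk (fBasis p n ⟨i, by omega⟩))
        rw [phiHat_mk, phi_fBasis_right, sub_eq_zero] at h
        exact h.symm
    refine Submodule.mem_span_singleton.2 ?_
    by_cases hn : 0 < 2 * n
    · refine ⟨x.1 ⟨0, hn⟩, Subtype.ext (funext fun i => ?_)⟩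
      rw [Submodule.coe_smul, Pi.smul_apply, hstep i i.2]
      exact mul_one _
    · exact ⟨0, Subtype.ext (funext fun i => absurd i.2 (by omega))⟩
  refine ⟨key, fun y hy => key y fun x => ?_⟩
  rw [phiHat_skew, hy, neg_zero]

theorem finrank_sympSpace (p n : ℕ) [Fact p.Prime] (hn : 1 ≤ n) :
    Module.finrank (ZMod p) (SympSpace p n) = 2 * (n - 1) := by
  have : Module.Finite (ZMod p) (AltSpace p n) := Module.Finite.of_basis (fBasis p n)
  have h1 := Submodule.finrank_quotient_add_finrank (trivAlt p n)
  have h2 : oneAlt p n ≠ 0 := by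
    intro h
    have h := congrFun (congrArg Subtype.val h) ⟨0, by omega⟩
    exact one_ne_zero (α := ZMod p) h
  rw [Module.finrank_eq_card_basis (fBasis p n), Fintype.card_fin, trivAlt,
    finrank_span_singleton h2] at h1
  change Module.finrank (ZMod p) (AltSpace p n ⧸ Submodule.span (ZMod p) {oneAlt p n}) = _
  omega

theorem ncard_isLagrangian (p n : ℕ) [Fact p.Prime] (hn : 1 ≤ n) :
    {L : Submodule (ZMod p) (SympSpace p n) | IsLagrangian p n L}.ncard =
      ∏ i ∈ Finset.Icc 1 (n - 1), (p ^ i + 1) := by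
  have : Module.Finite (ZMod p) (AltSpace p n) := Module.Finite.of_basis (fBasis p n)
  have : Finite (SympSpace p n) := Module.finite_of_finite (ZMod p)
  have h := natCard_isSelfPolar (phiHat_self p n) (phiHat_nondegenerate p n)
    (finrank_sympSpace p n hn)
  rw [Nat.card_zmod] at h
  rw [← h, ← Nat.card_coe_set_eq]
  exact Nat.card_congr (Equiv.subtypeEquivRight fun L => isLagrangian_iff_phiHat)

/-! ### Comparison of the counts and conclusion -/

/-- The factors for `i = 1, 2` agree; `i = 3` is the first strict inequality and occurs exactly when
`n > 3`. -/
theorem prod_two_mul_add_one_lt (n : ℕ) (hn : 3 < n) :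
    ∏ i ∈ Finset.Icc 1 (n - 1), (2 * i + 1) < ∏ i ∈ Finset.Icc 1 (n - 1), (2 ^ i + 1) := by
  refine Finset.prod_lt_prod (fun i _ => by omega) (fun i _ => ?_)
    ⟨3, Finset.mem_Icc.2 ⟨by omega, by omega⟩, by norm_num⟩
  have h : ∀ i : ℕ, 2 * i ≤ 2 ^ i := by
    intro i
    induction i with
    | zero => norm_num
    | succ i ih =>
      have := Nat.one_le_two_pow (n := i)
      rcases i with _ | i
      · norm_num
      · rw [pow_succ]; omega
  have := h i
  omega

theorem theorem2p5 (n : ℕ) (hn : 1 ≤ n) :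
    (∀ p : ℕ, p.Prime → p ≠ 2 → ∀ L : Submodule (ZMod p) (SympSpace p n), IsLagrangian p n L →
      ∃ T : TangleDiagram (2 * n), T.IsRational ∧ T.boundarySpace p = L) ∧
    ((3 < n → ∃ L : Submodule (ZMod 2) (SympSpace 2 n), IsLagrangian 2 n L ∧
        ∀ T : TangleDiagram (2 * n), T.boundarySpace 2 ≠ L) ∧
      {L : Submodule (ZMod 2) (SympSpace 2 n) | IsLagrangian 2 n L ∧
        ∃ T : TangleDiagram (2 * n), T.boundarySpace 2 = L}.ncard =
        ∏ i ∈ Finset.Icc 1 (n - 1), (2 * i + 1) ∧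
      (Set.range fun T : TangleDiagram (2 * n) => LinearMap.range (T.psi 2)).ncard =
        ∏ i ∈ Finset.Icc 1 (n - 1), (2 * i + 1) ∧
      {L : Submodule (ZMod 2) (SympSpace 2 n) | IsLagrangian 2 n L}.ncard =
        ∏ i ∈ Finset.Icc 1 (n - 1), (2 ^ i + 1)) := by
  refine ⟨fun p hp hp2 L hL => ?_, fun h3 => ?_, TangleDiagram.ncard_boundarySpace_two n hn,
    TangleDiagram.ncard_range_psi_two n hn, ncard_isLagrangian 2 n hn⟩
  · have : Fact p.Prime := ⟨hp⟩
    exact hL.exists_rational hp2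
  · by_contra! hall
    have hlt := prod_two_mul_add_one_lt n h3
    rw [← TangleDiagram.ncard_boundarySpace_two n hn, ← ncard_isLagrangian 2 n hn] at hlt
    refine hlt.ne (congrArg Set.ncard (Set.ext fun L => ?_))
    exact ⟨fun h => h.1, fun h => ⟨h, hall L h⟩⟩
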